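/- Let $\mathbb{D}\subset\mathbb{C}$ be the open unit disk. For a holomorphic $f\colon\mathbb{D}\to\mathbb{D}$ and $\sigma\in\partial\mathbb{D}$, the boundary dilation coefficient of $f$ at $\sigma$ is $$\beta_f(\sigma)=\inf_{\tau\in\partial\mathbb{D}}\ \sup_{z\in\mathbb{D}}\left\{\frac{|\tau-f(z)|^2}{1-|f(z)|^2}\Big/\frac{|\sigma-z|^2}{1-|z|^2}\right\}\in[0,+\infty],$$ and $f(\sigma)=c$ means that $f$ has non-tangential limit $c$ at $\sigma$, i.e. for every $M>1$, $f(z)\to c$ as $z\to\sigma$ within $\{z\in\mathbb{D}: |\sigma-z|/(1-|z|)<M\}$. A Blaschke product of degree $d$ is a map of the form $B(z)=e^{i\theta}\prod_{j=1}^d\frac{z-a_j}{1-\overline{a_j}z}$ with $\theta\in\mathbb{R}$ and $a_1,\dots,a_d\in\mathbb{D}$. **Proposition (Cowen–Pommerenke).** Let $f\colon\mathbb{D}\to\mathbb{D}$ be holomorphic, not an automorphism of $\mathbb{D}$, with $f(z_0)=z_0$ for some $z_0\in\mathbb{D}$. Let $\sigma_1,\dots,\sigma_n\in\partial\mathbb{D}$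 be distinct points such that $\beta_f(\sigma_j)<+\infty$ and $f(\sigma_j)=\sigma_j$ for $j=1,\dots,n$. Then $f'(z_0)\ne 1$, $\beta_f(\sigma_j)>1$ for every $j$, and $$\sum_{j=1}^n\frac{1}{\beta_f(\sigma_j)-1}\le\frac{1-|f'(z_0)|^2}{|1-f'(z_0)|^2}.$$ Moreover, equality holds if and only if $f$ is a Blaschke product of degree $n+1$. -/

import Mathlib

open scoped ENNReal Topology

noncomputable section

/-- The open unit disk in the complex plane. -/
def disk : Set ℂ := Metric.ball 0 1

/-- `f` restricts to a holomorphic self-map of the unit disk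
(the values of `f` outside the disk are irrelevant). -/
def IsHolSelfMap (f : ℂ → ℂ) : Prop :=
  DifferentiableOn ℂ f disk ∧ Set.MapsTo f disk disk

/-- `f` restricts to an automorphism of the unit disk: a holomorphic self-map with a holomorphic
inverse. -/
def IsDiskAut (f : ℂ → ℂ) : Prop :=
  IsHolSelfMap f ∧ ∃ g : ℂ → ℂ, IsHolSelfMap g ∧
    Set.LeftInvOn g f disk ∧ Set.RightInvOn g f disk

/-- The quantity `β_f(σ, τ)`, an element of `[0, ∞]`, for `σ` and `τ` on the unit circle. -/
def dilationAt (f : ℂ → ℂ) (σ τ : ℂ) : ℝ≥0∞ :=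
  ⨆ z ∈ disk, ENNReal.ofReal
    ((‖τ - f z‖ ^ 2 / (1 - ‖f z‖ ^ 2)) / (‖σ - z‖ ^ 2 / (1 - ‖z‖ ^ 2)))

/-- The boundary dilation coefficient `β_f(σ)`, an element of `[0, ∞]`, for `σ` on the
unit circle. -/
def boundaryDilation (f : ℂ → ℂ) (σ : ℂ) : ℝ≥0∞ :=
  ⨅ τ ∈ Metric.sphere (0 : ℂ) 1, dilationAt f σ τ

/-- The Stolz region of vertex `σ` and amplitude `M`. -/
def stolzRegion (σ : ℂ) (M : ℝ) : Set ℂ :=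
  {z | z ∈ disk ∧ ‖σ - z‖ / (1 - ‖z‖) < M}

/-- `f` has non-tangential (angular) limit `c` at the point `σ` of the unit circle. -/
def HasNontangentialLimit (f : ℂ → ℂ) (σ c : ℂ) : Prop :=
  ∀ M : ℝ, 1 < M → Filter.Tendsto f (𝓝[stolzRegion σ M] σ) (𝓝 c)

/-- `f` is, on the unit disk, a finite Blaschke product of degree `d`. -/
def IsBlaschkeProduct (d : ℕ) (f : ℂ → ℂ) : Prop :=
  ∃ (θ : ℝ) (a : Fin d → ℂ), (∀ j, a j ∈ disk) ∧
    ∀ z ∈ disk, f z = Complex.exp (Complex.I * θ) *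
      ∏ j, (z - a j) / (1 - (starRingEnd ℂ) (a j) * z)

end

open Complex ComplexConjugate Filter Polynomial

/-! ### Möbius maps and the Schwarz–Pick inequality -/

/-! Divide out the interior fixed point: `mobius z₀ (f z) = mobius z₀ z * q z`, where `q =
schwarzQuotient f z₀` and `q z₀ = f' z₀`. As `f` is not an automorphism, `q` maps the disk into
itself, so `F = (1 + q) / (1 - q)` (`herglotzFun`) has nonnegative real part, and `Re F z₀` is the
right-hand side of the inequality.

At a boundary fixed point `σ`, `q` tends radially to `1`, and comparing `1 - |f|²` with `1 - |q|²`
along the radius turns the dilation `β` of `f` into the dilation `(β - 1) P_σ(z₀)` of `q`, with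
`P_σ` the Poisson kernel. By Julia's lemma the largest `c` with `c P_σ ≤ Re F` is therefore `1 / ((β
- 1) P_σ(z₀))` (`boundaryDilation_spec`). Such lower bounds at distinct points add up
(`sum_mul_poisson_le_re`), and evaluation of the sum at `z₀` is the inequality. Harnack's inequality
replaces the Herglotz measure throughout.

In case of equality, `F - ∑ c_j H_{σ_j}`, with `H_σ` the Herglotz kernel, has nonnegative real part
vanishing at `z₀`, hence is an imaginary constant. Solving for `q`, then for `f`, gives a quotient
of polynomials reflected into each other, that is, a Blaschke product
(`isBlaschkeProduct_of_herglotzFun_eq`). Conversely, for a Blaschke product of degree `n + 1`, `q =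
p / b` with degrees at most `n`, and `b - p` vanishes at the `n` points `σ_j`. So `F` has only
simple poles there; maximality of the `c_j` removes them from `F - ∑ c_j H_{σ_j}`, leaving a
constant, imaginary because `|p| = |b|` on the circle (`IsBlaschkeProduct.re_herglotzFun_eq`). -/

theorem mem_disk_iff {z : ℂ} : z ∈ disk ↔ ‖z‖ < 1 := by
  simp [disk]

theorem isOpen_disk : IsOpen disk := Metric.isOpen_ball

theorem one_sub_norm_sq_pos {z : ℂ} (hz : z ∈ disk) : 0 < 1 - ‖z‖ ^ 2 := by
  have := mem_disk_iff.1 hz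
  nlinarith [norm_nonneg z]

theorem norm_one_sub_conj_mul_sq (a z : ℂ) :
    ‖1 - conj a * z‖ ^ 2 - ‖z - a‖ ^ 2 = (1 - ‖a‖ ^ 2) * (1 - ‖z‖ ^ 2) := by
  simp only [Complex.sq_norm, Complex.normSq_apply, Complex.sub_re, Complex.sub_im, Complex.mul_re,
    Complex.mul_im, Complex.conj_re, Complex.conj_im, Complex.one_re, Complex.one_im]
  ring

theorem one_sub_conj_mul_ne_zero {a z : ℂ} (ha : a ∈ disk) (hz : ‖z‖ ≤ 1) :
    1 - conj a * z ≠ 0 := by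
  intro h
  have h1 : conj a * z = 1 := (sub_eq_zero.1 h).symm
  have h2 : ‖a‖ * ‖z‖ = 1 := by
    rw [← Complex.norm_conj a, ← norm_mul, h1, norm_one]
  have := mem_disk_iff.1 ha
  nlinarith [norm_nonneg a, norm_nonneg z]

theorem norm_one_sub_conj_mul_of_mem_sphere {σ : ℂ} (hσ : ‖σ‖ = 1) (z : ℂ) :
    ‖1 - conj σ * z‖ = ‖σ - z‖ := by
  have : σ * (1 - conj σ * z) = σ - z := by
    have h : σ * conj σ = 1 := by
      rw [Complex.mul_conj, Complex.normSq_eq_norm_sq, hσ]; simp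
    linear_combination (-z) * h
  rw [← this, norm_mul, hσ, one_mul]

/-- The disk automorphism sending `a` to `0`. -/
noncomputable def mobius (a z : ℂ) : ℂ := (z - a) / (1 - conj a * z)

theorem one_sub_norm_mobius_sq {a z : ℂ} (ha : a ∈ disk) (hz : ‖z‖ ≤ 1) :
    1 - ‖mobius a z‖ ^ 2 = (1 - ‖a‖ ^ 2) * (1 - ‖z‖ ^ 2) / ‖1 - conj a * z‖ ^ 2 := by
  have h : ‖1 - conj a * z‖ ≠ 0 := norm_ne_zero_iff.2 (one_sub_conj_mul_ne_zero ha hz)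
  rw [mobius, norm_div, div_pow, ← norm_one_sub_conj_mul_sq, sub_div, div_self (pow_ne_zero 2 h)]

theorem mobius_mem_disk {a z : ℂ} (ha : a ∈ disk) (hz : z ∈ disk) : mobius a z ∈ disk := by
  have h := one_sub_norm_mobius_sq ha (mem_disk_iff.1 hz).le
  have h1 := norm_pos_iff.2 (one_sub_conj_mul_ne_zero ha (mem_disk_iff.1 hz).le)
  have h2 : 0 < 1 - ‖mobius a z‖ ^ 2 := by
    rw [h]
    have := one_sub_norm_sq_pos ha
    have := one_sub_norm_sq_pos hz
    positivity
  rw [mem_disk_iff]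
  nlinarith [norm_nonneg (mobius a z)]

theorem differentiableOn_mobius {a : ℂ} (ha : a ∈ disk) : DifferentiableOn ℂ (mobius a) disk := by
  unfold mobius
  refine DifferentiableOn.div (by fun_prop) (by fun_prop) fun z hz => ?_
  exact one_sub_conj_mul_ne_zero ha (mem_disk_iff.1 hz).le

theorem isHolSelfMap_mobius {a : ℂ} (ha : a ∈ disk) : IsHolSelfMap (mobius a) :=
  ⟨differentiableOn_mobius ha, fun _ hz => mobius_mem_disk ha hz⟩

theorem IsHolSelfMap.comp {f g : ℂ → ℂ} (hf : IsHolSelfMap f) (hg : IsHolSelfMap g) :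
    IsHolSelfMap (f ∘ g) :=
  ⟨hf.1.comp hg.1 hg.2, hf.2.comp hg.2⟩

theorem neg_mem_disk {a : ℂ} (ha : a ∈ disk) : -a ∈ disk := by
  rw [mem_disk_iff] at *; simpa

theorem mobius_neg_mobius {a z : ℂ} (ha : a ∈ disk) (hz : ‖z‖ ≤ 1) :
    mobius (-a) (mobius a z) = z := by
  have h := one_sub_conj_mul_ne_zero ha hz
  have h2 := one_sub_conj_mul_ne_zero ha (mem_disk_iff.1 ha).le
  have h3 : 1 - conj (-a) * mobius a z = (1 - conj a * a) / (1 - conj a * z) := by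
    rw [mobius, eq_div_iff h, map_neg, sub_mul, mul_assoc, div_mul_cancel₀ _ h]
    ring
  have h4 : mobius a z - -a = z * ((1 - conj a * a) / (1 - conj a * z)) := by
    rw [mobius, ← mul_div_assoc, eq_div_iff h, sub_mul, div_mul_cancel₀ _ h]
    ring
  rw [mobius, h3, h4, mul_div_cancel_right₀ _ (div_ne_zero h2 h)]

theorem mobius_mobius_neg {a z : ℂ} (ha : a ∈ disk) (hz : ‖z‖ ≤ 1) :
    mobius a (mobius (-a) z) = z := by
  simpa using mobius_neg_mobius (neg_mem_disk ha) hz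

/-- Schwarz's lemma for `f` after Möbius changes of variable sending `w` and `f w` to `0`. -/
theorem IsHolSelfMap.norm_mobius_le {f : ℂ → ℂ} (hf : IsHolSelfMap f) {z w : ℂ} (hz : z ∈ disk)
    (hw : w ∈ disk) : ‖mobius (f w) (f z)‖ ≤ ‖mobius w z‖ := by
  have hg : IsHolSelfMap (mobius (f w) ∘ f ∘ mobius (-w)) :=
    (isHolSelfMap_mobius (hf.2 hw)).comp (hf.comp (isHolSelfMap_mobius (neg_mem_disk hw)))
  have h := Complex.norm_le_norm_of_mapsTo_ball (z := mobius w z) hg.1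
    (fun x hx => Metric.ball_subset_closedBall (hg.2 hx))
    (by simp [mobius]) (mem_disk_iff.1 (mobius_mem_disk hw hz))
  simpa [mobius_neg_mobius hw (mem_disk_iff.1 hz).le] using h

/-- The **Schwarz–Pick inequality**. -/
theorem IsHolSelfMap.schwarz_pick {f : ℂ → ℂ} (hf : IsHolSelfMap f) {z w : ℂ} (hz : z ∈ disk)
    (hw : w ∈ disk) :
    ‖1 - conj (f w) * f z‖ ^ 2 * ((1 - ‖w‖ ^ 2) * (1 - ‖z‖ ^ 2)) ≤
      ‖1 - conj w * z‖ ^ 2 * ((1 - ‖f w‖ ^ 2) * (1 - ‖f z‖ ^ 2)) := by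
  have h : 1 - ‖mobius w z‖ ^ 2 ≤ 1 - ‖mobius (f w) (f z)‖ ^ 2 := by
    have := hf.norm_mobius_le hz hw
    gcongr
  rw [one_sub_norm_mobius_sq hw (mem_disk_iff.1 hz).le,
    one_sub_norm_mobius_sq (hf.2 hw) (mem_disk_iff.1 (hf.2 hz)).le] at h
  have h1 := norm_pos_iff.2 (one_sub_conj_mul_ne_zero hw (mem_disk_iff.1 hz).le)
  have h2 := norm_pos_iff.2 (one_sub_conj_mul_ne_zero (hf.2 hw) (mem_disk_iff.1 (hf.2 hz)).le)
  rw [div_le_div_iff₀ (by positivity) (by positivity)] at h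
  linarith

/-! ### Julia's lemma -/

/-- The Poisson kernel of the unit disk with pole `σ`. -/
noncomputable def poisson (σ z : ℂ) : ℝ := (1 - ‖z‖ ^ 2) / ‖σ - z‖ ^ 2

theorem sub_ne_zero_of_mem_disk {σ z : ℂ} (hσ : ‖σ‖ = 1) (hz : z ∈ disk) : σ - z ≠ 0 := by
  intro h
  rw [sub_eq_zero] at h
  subst h
  have := mem_disk_iff.1 hz
  linarith

theorem poisson_pos {σ z : ℂ} (hσ : ‖σ‖ = 1) (hz : z ∈ disk) : 0 < poisson σ z := by
  have := norm_pos_iff.2 (sub_ne_zero_of_mem_disk hσ hz)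
  have := one_sub_norm_sq_pos hz
  unfold poisson
  positivity

theorem eventually_mem_Ioo_zero_one : ∀ᶠ r : ℝ in 𝓝[<] 1, r ∈ Set.Ioo (0 : ℝ) 1 :=
  Ioo_mem_nhdsLT zero_lt_one

theorem norm_ofReal_mul {σ : ℂ} (hσ : ‖σ‖ = 1) {r : ℝ} (hr : r ∈ Set.Ioo (0 : ℝ) 1) :
    ‖(r : ℂ) * σ‖ = r := by
  rw [norm_mul, hσ, mul_one, Complex.norm_real, Real.norm_of_nonneg hr.1.le]

theorem ofReal_mul_mem_disk {σ : ℂ} (hσ : ‖σ‖ = 1) {r : ℝ} (hr : r ∈ Set.Ioo (0 : ℝ) 1) :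
    (r : ℂ) * σ ∈ disk := by
  rw [mem_disk_iff, norm_ofReal_mul hσ hr]
  exact hr.2

theorem tendsto_ofReal_mul (σ : ℂ) :
    Tendsto (fun r : ℝ => (r : ℂ) * σ) (𝓝[<] 1) (𝓝 σ) := by
  have h : Continuous fun r : ℝ => (r : ℂ) * σ := by fun_prop
  simpa using (h.tendsto 1).mono_left nhdsWithin_le_nhds

/-- **Julia's lemma** for self-maps of the disk. -/
theorem IsHolSelfMap.julia {f : ℂ → ℂ} (hf : IsHolSelfMap f) {σ τ : ℂ} (hσ : ‖σ‖ = 1)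
    (hτ : ‖τ‖ = 1) (hlim : Tendsto (fun r : ℝ => f (r * σ)) (𝓝[<] 1) (𝓝 τ)) {a : ℝ → ℝ} {α : ℝ}
    (ha : Tendsto a (𝓝[<] 1) (𝓝 α))
    (hfa : ∀ᶠ r : ℝ in 𝓝[<] 1, 1 - ‖f (r * σ)‖ ^ 2 ≤ a r * (1 - r ^ 2)) {z : ℂ} (hz : z ∈ disk) :
    ‖τ - f z‖ ^ 2 * (1 - ‖z‖ ^ 2) ≤ α * (‖σ - z‖ ^ 2 * (1 - ‖f z‖ ^ 2)) := by
  have hl : Tendsto (fun r : ℝ => ‖1 - conj (f (r * σ)) * f z‖ ^ 2 * (1 - ‖z‖ ^ 2)) (𝓝[<] 1)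
      (𝓝 (‖1 - conj τ * f z‖ ^ 2 * (1 - ‖z‖ ^ 2))) :=
    ((((tendsto_const_nhds.sub
      (((Complex.continuous_conj.tendsto _).comp hlim).mul_const _))).norm.pow 2).mul_const _)
  have hr : Tendsto (fun r : ℝ => a r * (‖1 - conj (r * σ) * z‖ ^ 2 * (1 - ‖f z‖ ^ 2)))
      (𝓝[<] 1) (𝓝 (α * (‖1 - conj σ * z‖ ^ 2 * (1 - ‖f z‖ ^ 2)))) :=
    ha.mul ((((tendsto_const_nhds.sub
      (((Complex.continuous_conj.tendsto _).comp (tendsto_ofReal_mul σ)).mul_const _))).norm.pow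
        2).mul_const _)
  rw [norm_one_sub_conj_mul_of_mem_sphere hτ] at hl
  rw [norm_one_sub_conj_mul_of_mem_sphere hσ] at hr
  -- Before the limit, this is Schwarz–Pick at `z` and `r * σ`, divided by `1 - r ^ 2`.
  refine le_of_tendsto_of_tendsto hl hr ?_
  filter_upwards [hfa, eventually_mem_Ioo_zero_one] with r h1 h2
  have hsp := hf.schwarz_pick hz (ofReal_mul_mem_disk hσ h2)
  rw [norm_ofReal_mul hσ h2] at hsp
  have hr2 : 0 < 1 - r ^ 2 := by nlinarith [h2.1, h2.2]
  have hfz := one_sub_norm_sq_pos (hf.2 hz)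
  have : ‖1 - conj (r * σ) * z‖ ^ 2 * ((1 - ‖f (r * σ)‖ ^ 2) * (1 - ‖f z‖ ^ 2)) ≤
      ‖1 - conj (r * σ) * z‖ ^ 2 * ((a r * (1 - r ^ 2)) * (1 - ‖f z‖ ^ 2)) := by gcongr
  refine le_of_mul_le_mul_right ?_ hr2
  linarith

/-! ### Harnack's inequality and Julia's lemma for the half-plane -/

theorem norm_sub_one_sq_add (G : ℂ) : ‖G + 1‖ ^ 2 - ‖G - 1‖ ^ 2 = 4 * G.re := by
  simp only [Complex.sq_norm, Complex.normSq_apply, Complex.sub_re, Complex.sub_im, Complex.add_re,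
    Complex.add_im, Complex.one_re, Complex.one_im]
  ring

theorem add_one_ne_zero_of_re_nonneg {G : ℂ} (h : 0 ≤ G.re) : G + 1 ≠ 0 := by
  intro h0
  have := congrArg Complex.re h0
  simp at this
  linarith

/-- A form of **Harnack's inequality** on the disk. -/
theorem harnack_of_re_pos {G : ℂ → ℂ} (hG : DifferentiableOn ℂ G disk)
    (hpos : ∀ z ∈ disk, 0 < (G z).re) {z w : ℂ} (hz : z ∈ disk) (hw : w ∈ disk) :
    (G w).re * ((1 - ‖w‖ ^ 2) * (1 - ‖z‖ ^ 2)) ≤ 4 * (G z).re * ‖1 - conj w * z‖ ^ 2 := by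
  have hne : ∀ z ∈ disk, G z + 1 ≠ 0 := fun z hz => add_one_ne_zero_of_re_nonneg (hpos z hz).le
  have hsq : ∀ z ∈ disk,
      1 - ‖(G z - 1) / (G z + 1)‖ ^ 2 = 4 * (G z).re / ‖G z + 1‖ ^ 2 := by
    intro z hz
    have := norm_pos_iff.2 (hne z hz)
    rw [← norm_sub_one_sq_add, norm_div]
    field_simp
  have hh : IsHolSelfMap fun z => (G z - 1) / (G z + 1) := by
    refine ⟨(hG.sub_const _).div (hG.add_const _) hne, fun z hz => ?_⟩
    have h1 := hsq z hz
    have h2 := norm_pos_iff.2 (hne z hz)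
    have h3 := hpos z hz
    have h4 : 0 < 1 - ‖(G z - 1) / (G z + 1)‖ ^ 2 := by rw [h1]; positivity
    rw [mem_disk_iff]
    nlinarith [norm_nonneg ((G z - 1) / (G z + 1))]
  have hsp := hh.schwarz_pick hz hw
  simp only [hsq z hz, hsq w hw] at hsp
  have hGz := norm_pos_iff.2 (hne z hz)
  have hGw := norm_pos_iff.2 (hne w hw)
  have hkey : ‖1 - conj ((G w - 1) / (G w + 1)) * ((G z - 1) / (G z + 1))‖ ^ 2 =
      4 * ‖conj (G w) + G z‖ ^ 2 / (‖G w + 1‖ ^ 2 * ‖G z + 1‖ ^ 2) := by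
    have e1 := hne z hz
    have e2 : conj (G w) + 1 ≠ 0 := by
      intro h
      apply hne w hw
      simpa using congrArg conj h
    have : 1 - conj ((G w - 1) / (G w + 1)) * ((G z - 1) / (G z + 1)) =
        2 * (conj (G w) + G z) / ((conj (G w) + 1) * (G z + 1)) := by
      simp only [map_div₀, map_sub, map_add, map_one]
      field_simp
      ring
    have e3 : ‖conj (G w) + 1‖ = ‖G w + 1‖ := by
      rw [← Complex.norm_conj (G w + 1)]; simp
    rw [this, norm_div, norm_mul, norm_mul, e3, div_pow, mul_pow, mul_pow]
    norm_num
  rw [hkey] at hsp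
  have hsp' : ‖conj (G w) + G z‖ ^ 2 * ((1 - ‖w‖ ^ 2) * (1 - ‖z‖ ^ 2)) ≤
      4 * (G w).re * (G z).re * ‖1 - conj w * z‖ ^ 2 := by
    have e : 0 < 4 / (‖G w + 1‖ ^ 2 * ‖G z + 1‖ ^ 2) := by positivity
    refine le_of_mul_le_mul_left ?_ e
    calc _ = _ := by ring
      _ ≤ _ := hsp
      _ = _ := by field_simp
  -- Dropping `(G z).re` is harmless in Julia's lemma below: a positive atom makes `(G w).re` blow
  -- up as `w` tends to the boundary point, and the factor `4` is then matched by `(1 + r) ^ 2 → 4`.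
  have hlow : (G w).re ^ 2 ≤ ‖conj (G w) + G z‖ ^ 2 := by
    have h1 := Complex.re_le_norm (conj (G w) + G z)
    simp only [Complex.add_re, Complex.conj_re] at h1
    have := hpos z hz
    have := hpos w hw
    gcongr
    linarith
  have hw' := hpos w hw
  have p1 := one_sub_norm_sq_pos hz
  have p2 := one_sub_norm_sq_pos hw
  have : (G w).re ^ 2 * ((1 - ‖w‖ ^ 2) * (1 - ‖z‖ ^ 2)) ≤
      ‖conj (G w) + G z‖ ^ 2 * ((1 - ‖w‖ ^ 2) * (1 - ‖z‖ ^ 2)) := by gcongr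
  refine le_of_mul_le_mul_left ?_ hw'
  calc _ = (G w).re ^ 2 * ((1 - ‖w‖ ^ 2) * (1 - ‖z‖ ^ 2)) := by ring
    _ ≤ _ := this.trans hsp'
    _ = _ := by ring

/-- Apply the strict version to `G + ε`. The equality case needs real parts that may vanish. -/
theorem harnack_of_re_nonneg {G : ℂ → ℂ} (hG : DifferentiableOn ℂ G disk)
    (hpos : ∀ z ∈ disk, 0 ≤ (G z).re) {z w : ℂ} (hz : z ∈ disk) (hw : w ∈ disk) :
    (G w).re * ((1 - ‖w‖ ^ 2) * (1 - ‖z‖ ^ 2)) ≤ 4 * (G z).re * ‖1 - conj w * z‖ ^ 2 := by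
  have h : ∀ᶠ ε : ℝ in 𝓝[>] 0, ((G w).re + ε) * ((1 - ‖w‖ ^ 2) * (1 - ‖z‖ ^ 2)) ≤
      4 * ((G z).re + ε) * ‖1 - conj w * z‖ ^ 2 := by
    filter_upwards [self_mem_nhdsWithin] with ε hε
    have := harnack_of_re_pos (G := fun z => G z + ε) (hG.add_const _)
      (fun z hz => by
        have := hpos z hz
        simp only [Complex.add_re, Complex.ofReal_re]
        have : 0 < ε := hε
        linarith) hz hw
    simpa using this
  refine le_of_tendsto_of_tendsto (b := 𝓝[>] (0 : ℝ)) ?_ ?_ h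
  · have : Continuous fun ε : ℝ => ((G w).re + ε) * ((1 - ‖w‖ ^ 2) * (1 - ‖z‖ ^ 2)) := by fun_prop
    simpa using (this.tendsto 0).mono_left nhdsWithin_le_nhds
  · have : Continuous fun ε : ℝ => 4 * ((G z).re + ε) * ‖1 - conj w * z‖ ^ 2 := by fun_prop
    simpa using (this.tendsto 0).mono_left nhdsWithin_le_nhds

/-- **Julia's lemma** for maps of the disk into the closed right half-plane. -/
theorem mul_poisson_le_re {G : ℂ → ℂ} (hG : DifferentiableOn ℂ G disk)
    (hpos : ∀ z ∈ disk, 0 ≤ (G z).re) {σ : ℂ} (hσ : ‖σ‖ = 1) {a : ℝ → ℝ} {c : ℝ}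
    (ha : Tendsto a (𝓝[<] 1) (𝓝 c))
    (hGa : ∀ᶠ r : ℝ in 𝓝[<] 1, a r ≤ (G (r * σ)).re * ((1 - r) / (1 + r))) {z : ℂ}
    (hz : z ∈ disk) : c * poisson σ z ≤ (G z).re := by
  have hl : Tendsto (fun r : ℝ => a r * (1 + r) ^ 2 * (1 - ‖z‖ ^ 2)) (𝓝[<] 1)
      (𝓝 (c * (1 + 1) ^ 2 * (1 - ‖z‖ ^ 2))) := by
    have : Tendsto (fun r : ℝ => r) (𝓝[<] 1) (𝓝 1) := nhdsWithin_le_nhds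
    exact (ha.mul ((this.const_add 1).pow 2)).mul_const _
  have hr : Tendsto (fun r : ℝ => 4 * (G z).re * ‖1 - conj (r * σ) * z‖ ^ 2)
      (𝓝[<] 1) (𝓝 (4 * (G z).re * ‖1 - conj σ * z‖ ^ 2)) :=
    ((((tendsto_const_nhds.sub
      (((Complex.continuous_conj.tendsto _).comp (tendsto_ofReal_mul σ)).mul_const _))).norm.pow
        2).const_mul _)
  rw [norm_one_sub_conj_mul_of_mem_sphere hσ] at hr
  have h : c * (1 + 1) ^ 2 * (1 - ‖z‖ ^ 2) ≤ 4 * (G z).re * ‖σ - z‖ ^ 2 := by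
    refine le_of_tendsto_of_tendsto hl hr ?_
    filter_upwards [hGa, eventually_mem_Ioo_zero_one] with r h1 h2
    have hh := harnack_of_re_nonneg hG hpos hz (ofReal_mul_mem_disk hσ h2)
    rw [norm_ofReal_mul hσ h2] at hh
    refine le_trans ?_ hh
    have h3 : 0 < 1 + r := by linarith [h2.1]
    have h4 := one_sub_norm_sq_pos hz
    calc a r * (1 + r) ^ 2 * (1 - ‖z‖ ^ 2)
        ≤ (G (r * σ)).re * ((1 - r) / (1 + r)) * (1 + r) ^ 2 * (1 - ‖z‖ ^ 2) := by gcongr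
      _ = _ := by field_simp; ring
  have := norm_pos_iff.2 (sub_ne_zero_of_mem_disk hσ hz)
  rw [poisson, ← mul_div_assoc, div_le_iff₀ (by positivity)]
  linarith

/-! ### The boundary dilation coefficient at a boundary fixed point -/

theorem norm_self_sub_ofReal_mul {σ : ℂ} (hσ : ‖σ‖ = 1) {r : ℝ} (hr : r ∈ Set.Ioo (0 : ℝ) 1) :
    ‖σ - r * σ‖ = 1 - r := by
  have : σ - r * σ = ((1 - r : ℝ) : ℂ) * σ := by push_cast; ring
  rw [this, norm_mul, hσ, mul_one, Complex.norm_real, Real.norm_of_nonneg (by linarith [hr.2])]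

/-- Only the radial limit is used later; on the radius the Stolz quotient equals `1`. -/
theorem HasNontangentialLimit.tendsto_radial {f : ℂ → ℂ} {σ c : ℂ} (hσ : ‖σ‖ = 1)
    (h : HasNontangentialLimit f σ c) :
    Tendsto (fun r : ℝ => f (r * σ)) (𝓝[<] 1) (𝓝 c) := by
  refine (h 2 one_lt_two).comp (tendsto_nhdsWithin_iff.2 ⟨tendsto_ofReal_mul σ, ?_⟩)
  filter_upwards [eventually_mem_Ioo_zero_one] with r hr
  refine ⟨ofReal_mul_mem_disk hσ hr, ?_⟩
  rw [norm_self_sub_ofReal_mul hσ hr, norm_ofReal_mul hσ hr, div_self (by linarith [hr.2])]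
  exact one_lt_two

theorem dilation_quotient_le_iff {s t u v γ : ℝ} (ht : 0 < t) (hu : 0 < u) (hv : 0 < v) :
    s / t / (u / v) ≤ γ ↔ s * v ≤ γ * (u * t) := by
  rw [div_le_iff₀ (div_pos hu hv), div_le_iff₀ ht, ← mul_div_assoc, div_mul_eq_mul_div,
    le_div_iff₀ hv, mul_assoc]

theorem dilationAt_le_ofReal_iff {f : ℂ → ℂ} (hf : IsHolSelfMap f) {σ τ : ℂ} (hσ : ‖σ‖ = 1)
    {γ : ℝ} (hγ : 0 ≤ γ) : dilationAt f σ τ ≤ ENNReal.ofReal γ ↔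
      ∀ z ∈ disk, ‖τ - f z‖ ^ 2 * (1 - ‖z‖ ^ 2) ≤ γ * (‖σ - z‖ ^ 2 * (1 - ‖f z‖ ^ 2)) := by
  unfold dilationAt
  rw [iSup₂_le_iff]
  refine forall₂_congr fun z hz => ?_
  rw [ENNReal.ofReal_le_ofReal_iff hγ, dilation_quotient_le_iff (one_sub_norm_sq_pos (hf.2 hz))
    (pow_pos (norm_pos_iff.2 (sub_ne_zero_of_mem_disk hσ hz)) 2) (one_sub_norm_sq_pos hz)]

/-- At `r * σ` the dilation inequality gives `‖τ - f (r * σ)‖ ^ 2 ≤ γ * (1 - r)`. -/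
theorem tendsto_radial_of_dilationAt_lt_top {f : ℂ → ℂ} (hf : IsHolSelfMap f) {σ τ : ℂ}
    (hσ : ‖σ‖ = 1) (h : dilationAt f σ τ < ⊤) :
    Tendsto (fun r : ℝ => f (r * σ)) (𝓝[<] 1) (𝓝 τ) := by
  have hb := (dilationAt_le_ofReal_iff hf hσ ENNReal.toReal_nonneg).1
    (ENNReal.ofReal_toReal h.ne).ge
  set γ := (dilationAt f σ τ).toReal with hγ
  have hγ0 : 0 ≤ γ := ENNReal.toReal_nonneg
  have hsq : Tendsto (fun r : ℝ => ‖τ - f (r * σ)‖ ^ 2) (𝓝[<] 1) (𝓝 0) := by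
    have hlim : Tendsto (fun r : ℝ => γ * (1 - r)) (𝓝[<] 1) (𝓝 0) := by
      have : Continuous fun r : ℝ => γ * (1 - r) := by fun_prop
      simpa using (this.tendsto 1).mono_left nhdsWithin_le_nhds
    refine squeeze_zero' (Eventually.of_forall fun r => by positivity) ?_ hlim
    filter_upwards [eventually_mem_Ioo_zero_one] with r hr
    have h1 := hb _ (ofReal_mul_mem_disk hσ hr)
    rw [norm_ofReal_mul hσ hr, norm_self_sub_ofReal_mul hσ hr] at h1
    have hpos : 0 < 1 - r := by linarith [hr.2]
    have h2 : γ * ((1 - r) ^ 2 * (1 - ‖f (r * σ)‖ ^ 2)) ≤ γ * ((1 - r) ^ 2 * 1) := by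
      gcongr
      linarith [sq_nonneg ‖f (r * σ)‖]
    have h3 : ‖τ - f (r * σ)‖ ^ 2 * 1 ≤ ‖τ - f (r * σ)‖ ^ 2 * (1 + r) := by
      gcongr
      linarith [hr.1]
    refine le_of_mul_le_mul_right ?_ hpos
    nlinarith
  have hn : Tendsto (fun r : ℝ => ‖f (r * σ) - τ‖) (𝓝[<] 1) (𝓝 0) := by
    have := (Real.continuous_sqrt.tendsto 0).comp hsq
    simpa [Function.comp_def, Real.sqrt_sq, norm_sub_rev] using this
  exact tendsto_iff_norm_sub_tendsto_zero.2 hn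

/-- A finite value at `τ` makes `τ` the radial limit, so every `τ ≠ σ` contributes `∞` to the
infimum. -/
theorem boundaryDilation_eq_dilationAt {f : ℂ → ℂ} (hf : IsHolSelfMap f) {σ : ℂ} (hσ : ‖σ‖ = 1)
    (hfix : Tendsto (fun r : ℝ => f (r * σ)) (𝓝[<] 1) (𝓝 σ)) :
    boundaryDilation f σ = dilationAt f σ σ := by
  refine le_antisymm (iInf₂_le σ (by simpa using hσ)) (le_iInf₂ fun τ _ => ?_)
  by_cases h : dilationAt f σ τ < ⊤
  · rw [tendsto_nhds_unique hfix (tendsto_radial_of_dilationAt_lt_top hf hσ h)]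
  · rw [not_lt_top_iff.1 h]
    exact le_top

/-! ### The Schwarz quotient -/

/-- For a self-map `f` of the disk fixing `z₀`, the holomorphic extension of
`mobius z₀ (f z) / mobius z₀ z` across `z₀`. -/
noncomputable def schwarzQuotient (f : ℂ → ℂ) (z₀ z : ℂ) : ℂ :=
  dslope f z₀ z * ((1 - conj z₀ * z) / (1 - conj z₀ * f z))

section SchwarzQuotient

variable {f : ℂ → ℂ} {z₀ : ℂ}

theorem schwarzQuotient_self (hz₀ : z₀ ∈ disk) (hfix : f z₀ = z₀) :
    schwarzQuotient f z₀ z₀ = deriv f z₀ := by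
  rw [schwarzQuotient, dslope_same, hfix,
    div_self (one_sub_conj_mul_ne_zero hz₀ (mem_disk_iff.1 hz₀).le), mul_one]

theorem mobius_mul_schwarzQuotient (hz₀ : z₀ ∈ disk) (hfix : f z₀ = z₀) {z : ℂ} (hz : z ∈ disk) :
    mobius z₀ z * schwarzQuotient f z₀ z = mobius z₀ (f z) := by
  have h1 : (z - z₀) * dslope f z₀ z = f z - z₀ := by
    have := sub_smul_dslope f z₀ z
    rwa [smul_eq_mul, hfix] at this
  have h2 := one_sub_conj_mul_ne_zero hz₀ (mem_disk_iff.1 hz).le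
  calc mobius z₀ z * schwarzQuotient f z₀ z
      = (z - z₀) * dslope f z₀ z * ((1 - conj z₀ * z) / (1 - conj z₀ * z))
          / (1 - conj z₀ * f z) := by unfold mobius schwarzQuotient; ring
    _ = mobius z₀ (f z) := by rw [h1, div_self h2, mul_one, mobius]

theorem differentiableOn_schwarzQuotient (hf : IsHolSelfMap f) (hz₀ : z₀ ∈ disk) :
    DifferentiableOn ℂ (schwarzQuotient f z₀) disk := by
  refine ((Complex.differentiableOn_dslope (isOpen_disk.mem_nhds hz₀)).2 hf.1).mul
    (DifferentiableOn.div (by fun_prop) ?_ fun z hz => ?_)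
  · exact (hf.1.const_mul _).const_sub _
  · exact one_sub_conj_mul_ne_zero hz₀ (mem_disk_iff.1 (hf.2 hz)).le

theorem mobius_ne_zero {z : ℂ} (hz₀ : z₀ ∈ disk) (hz : ‖z‖ ≤ 1) (hne : z ≠ z₀) :
    mobius z₀ z ≠ 0 :=
  div_ne_zero (sub_ne_zero.2 hne) (one_sub_conj_mul_ne_zero hz₀ hz)

theorem norm_schwarzQuotient_le_one (hf : IsHolSelfMap f) (hz₀ : z₀ ∈ disk) (hfix : f z₀ = z₀)
    {z : ℂ} (hz : z ∈ disk) : ‖schwarzQuotient f z₀ z‖ ≤ 1 := by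
  have hne : ∀ w ∈ disk, w ≠ z₀ → ‖schwarzQuotient f z₀ w‖ ≤ 1 := by
    intro w hw hwz
    have h := hf.norm_mobius_le hw hz₀
    rw [hfix, ← mobius_mul_schwarzQuotient hz₀ hfix hw, norm_mul] at h
    exact le_of_mul_le_mul_left (by simpa using h)
      (norm_pos_iff.2 (mobius_ne_zero hz₀ (mem_disk_iff.1 hw).le hwz))
  rcases ne_or_eq z z₀ with h | rfl
  · exact hne z hz h
  · have hc := ((differentiableOn_schwarzQuotient hf hz₀).continuousOn.continuousAt
      (isOpen_disk.mem_nhds hz)).norm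
    refine le_of_tendsto (x := 𝓝[≠] z) (hc.tendsto.mono_left nhdsWithin_le_nhds) ?_
    filter_upwards [self_mem_nhdsWithin, nhdsWithin_le_nhds (isOpen_disk.mem_nhds hz)] with w h1 h2
    exact hne w h2 h1

theorem isDiskAut_of_mobius_eq (hf : IsHolSelfMap f) (hz₀ : z₀ ∈ disk) {u : ℂ} (hu : ‖u‖ = 1)
    (h : ∀ z ∈ disk, mobius z₀ (f z) = u * mobius z₀ z) : IsDiskAut f := by
  have huu : conj u * u = 1 := by
    rw [Complex.conj_mul', hu]; simp
  have hneg := neg_mem_disk hz₀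
  have hmem : ∀ v : ℂ, ‖v‖ = 1 → ∀ z ∈ disk, v * z ∈ disk := by
    intro v hv z hz
    rw [mem_disk_iff] at *
    rwa [norm_mul, hv, one_mul]
  have hcu : ‖conj u‖ = 1 := by rwa [Complex.norm_conj]
  have hrot : IsHolSelfMap fun z => conj u * z :=
    ⟨by fun_prop, hmem _ hcu⟩
  refine ⟨hf, mobius (-z₀) ∘ (fun z => conj u * z) ∘ mobius z₀,
    (isHolSelfMap_mobius hneg).comp (hrot.comp (isHolSelfMap_mobius hz₀)), ?_, ?_⟩
  · intro z hz
    simp only [Function.comp_apply, h z hz, ← mul_assoc, huu, one_mul]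
    exact mobius_neg_mobius hz₀ (mem_disk_iff.1 hz).le
  · intro z hz
    have hw : conj u * mobius z₀ z ∈ disk := hmem _ hcu _ (mobius_mem_disk hz₀ hz)
    have hg : mobius (-z₀) (conj u * mobius z₀ z) ∈ disk := mobius_mem_disk hneg hw
    have h1 := h _ hg
    rw [mobius_mobius_neg hz₀ (mem_disk_iff.1 hw).le, ← mul_assoc, mul_comm u, huu, one_mul] at h1
    have h2 := congrArg (mobius (-z₀)) h1
    rw [mobius_neg_mobius hz₀ (mem_disk_iff.1 hz).le,
      mobius_neg_mobius hz₀ (mem_disk_iff.1 (hf.2 hg)).le] at h2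
    exact h2

/-- If the quotient had modulus `1` at some point, the maximum principle would make it a unimodular
constant, and `f` would be a rotation in the coordinate `mobius z₀`. -/
theorem isHolSelfMap_schwarzQuotient (hf : IsHolSelfMap f) (haut : ¬ IsDiskAut f)
    (hz₀ : z₀ ∈ disk) (hfix : f z₀ = z₀) : IsHolSelfMap (schwarzQuotient f z₀) := by
  have hd := differentiableOn_schwarzQuotient hf hz₀
  refine ⟨hd, fun w hw => ?_⟩
  rw [mem_disk_iff]
  refine lt_of_le_of_ne (norm_schwarzQuotient_le_one hf hz₀ hfix hw) fun h1 => haut ?_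
  have hmax : IsMaxOn (norm ∘ schwarzQuotient f z₀) disk w := by
    refine isMaxOn_iff.2 fun z hz => ?_
    simpa [h1] using norm_schwarzQuotient_le_one hf hz₀ hfix hz
  have heq := Complex.eqOn_of_isPreconnected_of_isMaxOn_norm
    (convex_ball (0 : ℂ) 1).isPreconnected isOpen_disk hd hw hmax
  refine isDiskAut_of_mobius_eq hf hz₀ h1 fun z hz => ?_
  rw [← mobius_mul_schwarzQuotient hz₀ hfix hz, heq hz, mul_comm]
  rfl

/-! ### Dilation of `f` versus dilation of its Schwarz quotient -/

/-- Converts a dilation inequality at `r * σ` into the hypothesis of `IsHolSelfMap.julia`, with `t`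
the modulus of the value and `s` its distance to the target. After `1 - t ≤ s`, the factor `(1 - t)
* (1 - r)` cancels; the correction `((1 + t) / (1 + r)) ^ 2` tends to `1` when `t` does. -/
theorem one_sub_sq_le_of_radial {t r α : ℝ} (ht : t < 1) (ht0 : 0 ≤ t)
    (hr : r ∈ Set.Ioo (0 : ℝ) 1) {s : ℝ} (hs : 1 - t ≤ s)
    (h : s ^ 2 * (1 - r ^ 2) ≤ α * ((1 - r) ^ 2 * (1 - t ^ 2))) :
    1 - t ^ 2 ≤ α * ((1 + t) / (1 + r)) ^ 2 * (1 - r ^ 2) := by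
  obtain ⟨hr0, hr1⟩ := hr
  have h0 : (1 - t) ^ 2 * (1 - r ^ 2) ≤ s ^ 2 * (1 - r ^ 2) := by
    have : 0 ≤ 1 - r ^ 2 := by nlinarith
    have : 0 ≤ 1 - t := by linarith
    gcongr
  have h1 : (1 - t) * (1 + r) ≤ α * ((1 - r) * (1 + t)) := by
    refine le_of_mul_le_mul_left ?_ (mul_pos (sub_pos.2 ht) (sub_pos.2 hr1))
    nlinarith
  rw [div_pow, mul_div_assoc', div_mul_eq_mul_div, le_div_iff₀ (by positivity)]
  have h2 : (1 - t) * (1 + r) * ((1 + t) * (1 + r)) ≤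
      α * ((1 - r) * (1 + t)) * ((1 + t) * (1 + r)) := by gcongr
  linarith

theorem one_sub_norm_le {σ w : ℂ} (hσ : ‖σ‖ = 1) : 1 - ‖w‖ ≤ ‖σ - w‖ := by
  have := norm_sub_norm_le σ w
  rwa [hσ] at this

theorem continuousAt_mobius (hz₀ : z₀ ∈ disk) {σ : ℂ} (hσ : ‖σ‖ ≤ 1) :
    ContinuousAt (mobius z₀) σ := by
  unfold mobius
  exact ContinuousAt.div (by fun_prop) (by fun_prop) (one_sub_conj_mul_ne_zero hz₀ hσ)

theorem norm_mobius_of_mem_sphere (hz₀ : z₀ ∈ disk) {σ : ℂ} (hσ : ‖σ‖ = 1) :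
    ‖mobius z₀ σ‖ = 1 := by
  have h := one_sub_norm_mobius_sq hz₀ hσ.le
  rw [hσ] at h
  have h2 : ‖mobius z₀ σ‖ ^ 2 = 1 := by
    have : (1 - ‖z₀‖ ^ 2) * (1 - 1 ^ 2) / ‖1 - conj z₀ * σ‖ ^ 2 = 0 := by simp
    linarith
  nlinarith [norm_nonneg (mobius z₀ σ)]

theorem norm_one_sub_conj_mul_comm (a b : ℂ) : ‖1 - conj a * b‖ = ‖1 - conj b * a‖ := by
  rw [← Complex.norm_conj (1 - conj a * b)]
  simp [mul_comm]

theorem poisson_eq {σ : ℂ} (hσ : ‖σ‖ = 1) :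
    (1 - ‖z₀‖ ^ 2) / ‖1 - conj z₀ * σ‖ ^ 2 = poisson σ z₀ := by
  rw [norm_one_sub_conj_mul_comm, norm_one_sub_conj_mul_of_mem_sphere hσ, poisson]

theorem tendsto_schwarzQuotient (hz₀ : z₀ ∈ disk) (hfix : f z₀ = z₀) {σ : ℂ}
    (hσ : ‖σ‖ = 1) (hlim : Tendsto (fun r : ℝ => f (r * σ)) (𝓝[<] 1) (𝓝 σ)) :
    Tendsto (fun r : ℝ => schwarzQuotient f z₀ (r * σ)) (𝓝[<] 1) (𝓝 1) := by
  have hne : mobius z₀ σ ≠ 0 := by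
    rw [← norm_ne_zero_iff, norm_mobius_of_mem_sphere hz₀ hσ]; exact one_ne_zero
  have hm := (continuousAt_mobius hz₀ hσ.le).tendsto.comp (tendsto_ofReal_mul σ)
  have hq := ((continuousAt_mobius hz₀ hσ.le).tendsto.comp hlim).div hm hne
  rw [div_self hne] at hq
  refine hq.congr' ?_
  filter_upwards [eventually_mem_Ioo_zero_one, hm.eventually_ne hne] with r hr hr2
  simp only [Pi.div_apply, Function.comp_apply] at hr2 ⊢
  rw [← mobius_mul_schwarzQuotient hz₀ hfix (ofReal_mul_mem_disk hσ hr),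
    mul_div_cancel_left₀ _ hr2]

theorem tendsto_one_add_div {t : ℝ → ℝ} (ht : Tendsto t (𝓝[<] 1) (𝓝 1)) :
    Tendsto (fun r : ℝ => ((1 + t r) / (1 + r)) ^ 2) (𝓝[<] 1) (𝓝 1) := by
  have hid : Tendsto (fun r : ℝ => r) (𝓝[<] 1) (𝓝 1) := nhdsWithin_le_nhds
  have := ((ht.const_add 1).div (hid.const_add 1) (by norm_num)).pow 2
  simpa using this

theorem tendsto_poisson {g : ℝ → ℂ} {σ : ℂ} (hz₀ : z₀ ∈ disk) (hσ : ‖σ‖ = 1)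
    (hg : Tendsto g (𝓝[<] 1) (𝓝 σ)) :
    Tendsto (fun r : ℝ => (1 - ‖z₀‖ ^ 2) / ‖1 - conj z₀ * g r‖ ^ 2) (𝓝[<] 1)
      (𝓝 (poisson σ z₀)) := by
  rw [← poisson_eq hσ]
  refine Tendsto.div tendsto_const_nhds (((hg.const_mul _).const_sub 1).norm.pow 2) ?_
  exact pow_ne_zero 2 (norm_ne_zero_iff.2 (one_sub_conj_mul_ne_zero hz₀ hσ.le))

/-- With `m = mobius z₀ (r * σ)`, write `|m|² (1 - |q|²) = (1 - |m|²|q|²) - (1 - |m|²)`. Relative to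
`1 - r²`, the first term is asymptotically at most `β P_σ(z₀)` and the second tends to `P_σ(z₀)`.
Julia's lemma for `q` with target `1` then has constant `(β - 1) P_σ(z₀)`. -/
theorem schwarzQuotient_julia (hf : IsHolSelfMap f) (haut : ¬ IsDiskAut f) (hz₀ : z₀ ∈ disk)
    (hfix : f z₀ = z₀) {σ : ℂ} (hσ : ‖σ‖ = 1)
    (hlim : Tendsto (fun r : ℝ => f (r * σ)) (𝓝[<] 1) (𝓝 σ)) {β : ℝ}
    (hβ : ∀ z ∈ disk, ‖σ - f z‖ ^ 2 * (1 - ‖z‖ ^ 2) ≤ β * (‖σ - z‖ ^ 2 * (1 - ‖f z‖ ^ 2)))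
    {z : ℂ} (hz : z ∈ disk) :
    ‖1 - schwarzQuotient f z₀ z‖ ^ 2 * (1 - ‖z‖ ^ 2) ≤
      ((β - 1) * poisson σ z₀) * (‖σ - z‖ ^ 2 * (1 - ‖schwarzQuotient f z₀ z‖ ^ 2)) := by
  have hq := isHolSelfMap_schwarzQuotient hf haut hz₀ hfix
  have hm1 := norm_mobius_of_mem_sphere hz₀ hσ
  have hm := ((continuousAt_mobius hz₀ hσ.le).tendsto.comp (tendsto_ofReal_mul σ)).norm
  rw [hm1] at hm
  have hA := (tendsto_one_add_div (by simpa [hσ] using hlim.norm)).const_mul β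
  have ha := ((((tendsto_poisson hz₀ hσ hlim).mul hA).sub
    (tendsto_poisson hz₀ hσ (tendsto_ofReal_mul σ))).div (hm.pow 2) (by norm_num))
  have e : (poisson σ z₀ * (β * 1) - poisson σ z₀) / 1 ^ 2 = (β - 1) * poisson σ z₀ := by ring
  rw [e] at ha
  refine hq.julia hσ norm_one (tendsto_schwarzQuotient hz₀ hfix hσ hlim) ha ?_ hz
  filter_upwards [eventually_mem_Ioo_zero_one, hm.eventually_ne one_ne_zero] with r hr hr2
  have hw := ofReal_mul_mem_disk hσ hr
  have hfw := hf.2 hw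
  have h1 := hβ _ hw
  rw [norm_ofReal_mul hσ hr, norm_self_sub_ofReal_mul hσ hr] at h1
  have h2 := one_sub_sq_le_of_radial (mem_disk_iff.1 hfw) (norm_nonneg _) hr (one_sub_norm_le hσ) h1
  simp only [Function.comp_apply] at hr2 ⊢
  have hpos : 0 < ‖mobius z₀ (r * σ)‖ ^ 2 := pow_pos ((norm_nonneg _).lt_of_ne' hr2) 2
  have h3 := one_sub_norm_mobius_sq hz₀ (mem_disk_iff.1 hw).le
  have h4 := one_sub_norm_mobius_sq hz₀ (mem_disk_iff.1 hfw).le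
  rw [norm_ofReal_mul hσ hr] at h3
  rw [← mobius_mul_schwarzQuotient hz₀ hfix hw, norm_mul, mul_pow] at h4
  rw [Pi.div_apply, div_mul_eq_mul_div, le_div_iff₀ hpos]
  have hc := norm_pos_iff.2 (one_sub_conj_mul_ne_zero hz₀ (mem_disk_iff.1 hfw).le)
  have hz0 := one_sub_norm_sq_pos hz₀
  have h5 : (1 - ‖z₀‖ ^ 2) * (1 - ‖f (r * σ)‖ ^ 2) / ‖1 - conj z₀ * f (r * σ)‖ ^ 2 ≤
      (1 - ‖z₀‖ ^ 2) * (β * ((1 + ‖f (r * σ)‖) / (1 + r)) ^ 2 * (1 - r ^ 2)) /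
        ‖1 - conj z₀ * f (r * σ)‖ ^ 2 := by gcongr
  have e2 : (1 - ‖schwarzQuotient f z₀ (r * σ)‖ ^ 2) * ‖mobius z₀ (r * σ)‖ ^ 2 =
      (1 - ‖mobius z₀ (r * σ)‖ ^ 2 * ‖schwarzQuotient f z₀ (r * σ)‖ ^ 2) -
      (1 - ‖mobius z₀ (r * σ)‖ ^ 2) := by ring
  rw [e2, h3, h4]
  refine (sub_le_sub_right h5 _).trans_eq ?_
  ring

/-- The converse transfer: the same identity, solved for `1 - |m|²|q|²`, feeds Julia's lemma for
`f`. -/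
theorem dilation_le_of_schwarzQuotient (hf : IsHolSelfMap f) (haut : ¬ IsDiskAut f)
    (hz₀ : z₀ ∈ disk) (hfix : f z₀ = z₀) {σ : ℂ} (hσ : ‖σ‖ = 1)
    (hlim : Tendsto (fun r : ℝ => f (r * σ)) (𝓝[<] 1) (𝓝 σ)) {β : ℝ}
    (hβ : ∀ z ∈ disk, ‖1 - schwarzQuotient f z₀ z‖ ^ 2 * (1 - ‖z‖ ^ 2) ≤
      ((β - 1) * poisson σ z₀) * (‖σ - z‖ ^ 2 * (1 - ‖schwarzQuotient f z₀ z‖ ^ 2)))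
    {z : ℂ} (hz : z ∈ disk) :
    ‖σ - f z‖ ^ 2 * (1 - ‖z‖ ^ 2) ≤ β * (‖σ - z‖ ^ 2 * (1 - ‖f z‖ ^ 2)) := by
  have hq := isHolSelfMap_schwarzQuotient hf haut hz₀ hfix
  have hm1 := norm_mobius_of_mem_sphere hz₀ hσ
  have hm := ((continuousAt_mobius hz₀ hσ.le).tendsto.comp (tendsto_ofReal_mul σ)).norm
  rw [hm1] at hm
  have hP := poisson_pos hσ hz₀
  have hA := (tendsto_one_add_div
    (by simpa using (tendsto_schwarzQuotient hz₀ hfix hσ hlim).norm)).const_mul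
      ((β - 1) * poisson σ z₀)
  have ha := ((tendsto_poisson hz₀ hσ (tendsto_ofReal_mul σ)).add ((hm.pow 2).mul hA)).div
    (tendsto_poisson hz₀ hσ hlim) hP.ne'
  have e : (poisson σ z₀ + 1 ^ 2 * ((β - 1) * poisson σ z₀ * 1)) / poisson σ z₀ = β := by
    field_simp; ring
  rw [e] at ha
  refine hf.julia hσ hσ hlim ha ?_ hz
  filter_upwards [eventually_mem_Ioo_zero_one] with r hr
  have hw := ofReal_mul_mem_disk hσ hr
  have hfw := hf.2 hw
  have h1 := hβ _ hw
  rw [norm_ofReal_mul hσ hr, norm_self_sub_ofReal_mul hσ hr] at h1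
  have h2 := one_sub_sq_le_of_radial (mem_disk_iff.1 (hq.2 hw)) (norm_nonneg _) hr
    (one_sub_norm_le norm_one) h1
  have h3 := one_sub_norm_mobius_sq hz₀ (mem_disk_iff.1 hw).le
  have h4 := one_sub_norm_mobius_sq hz₀ (mem_disk_iff.1 hfw).le
  rw [norm_ofReal_mul hσ hr] at h3
  rw [← mobius_mul_schwarzQuotient hz₀ hfix hw, norm_mul, mul_pow] at h4
  have hc := norm_pos_iff.2 (one_sub_conj_mul_ne_zero hz₀ (mem_disk_iff.1 hfw).le)
  have hz0 := one_sub_norm_sq_pos hz₀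
  simp only [Pi.div_apply, Function.comp_apply]
  rw [div_mul_eq_mul_div, le_div_iff₀ (by positivity)]
  have e2 : 1 - ‖mobius z₀ (r * σ)‖ ^ 2 * ‖schwarzQuotient f z₀ (r * σ)‖ ^ 2 =
      (1 - ‖mobius z₀ (r * σ)‖ ^ 2) + ‖mobius z₀ (r * σ)‖ ^ 2 *
        (1 - ‖schwarzQuotient f z₀ (r * σ)‖ ^ 2) := by ring
  calc (1 - ‖f (r * σ)‖ ^ 2) * ((1 - ‖z₀‖ ^ 2) / ‖1 - conj z₀ * f (r * σ)‖ ^ 2)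
      = (1 - ‖z₀‖ ^ 2) * (1 - ‖f (r * σ)‖ ^ 2) / ‖1 - conj z₀ * f (r * σ)‖ ^ 2 := by ring
    _ = (1 - ‖mobius z₀ (r * σ)‖ ^ 2) + ‖mobius z₀ (r * σ)‖ ^ 2 *
        (1 - ‖schwarzQuotient f z₀ (r * σ)‖ ^ 2) := by rw [← h4, e2]
    _ ≤ (1 - ‖z₀‖ ^ 2) * (1 - r ^ 2) / ‖1 - conj z₀ * (r * σ)‖ ^ 2 +
        ‖mobius z₀ (r * σ)‖ ^ 2 * ((β - 1) * poisson σ z₀ *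
          ((1 + ‖schwarzQuotient f z₀ (r * σ)‖) / (1 + r)) ^ 2 * (1 - r ^ 2)) := by
        rw [h3]; gcongr
    _ = _ := by ring

end SchwarzQuotient

/-! ### Atoms of holomorphic functions with nonnegative real part -/

/-- The Herglotz kernel of the disk, whose real part is the Poisson kernel. -/
noncomputable def herglotzKernel (σ z : ℂ) : ℂ := (σ + z) / (σ - z)

theorem re_add_div_sub (a b : ℂ) :
    ((a + b) / (a - b)).re = (‖a‖ ^ 2 - ‖b‖ ^ 2) / ‖a - b‖ ^ 2 := by
  rw [Complex.div_re, ← add_div]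
  simp only [Complex.sq_norm, Complex.normSq_apply, Complex.sub_re, Complex.sub_im, Complex.add_re,
    Complex.add_im]
  congr 1
  ring

theorem re_herglotzKernel {σ : ℂ} (hσ : ‖σ‖ = 1) (z : ℂ) :
    (herglotzKernel σ z).re = poisson σ z := by
  rw [herglotzKernel, re_add_div_sub, poisson, hσ, one_pow]

theorem differentiableOn_herglotzKernel {σ : ℂ} (hσ : ‖σ‖ = 1) :
    DifferentiableOn ℂ (herglotzKernel σ) disk := by
  unfold herglotzKernel
  exact DifferentiableOn.div (by fun_prop) (by fun_prop) fun z hz => sub_ne_zero_of_mem_disk hσ hz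

theorem poisson_ofReal_mul {σ : ℂ} (hσ : ‖σ‖ = 1) {r : ℝ} (hr : r ∈ Set.Ioo (0 : ℝ) 1) :
    poisson σ (r * σ) * ((1 - r) / (1 + r)) = 1 := by
  rw [poisson, norm_ofReal_mul hσ hr, norm_self_sub_ofReal_mul hσ hr]
  have h1 : 1 - r ≠ 0 := by linarith [hr.2]
  have h2 : 1 + r ≠ 0 := by linarith [hr.1]
  field_simp
  ring

theorem tendsto_poisson_radial_of_ne {σ τ : ℂ} (hne : τ ≠ σ) :
    Tendsto (fun r : ℝ => poisson τ (r * σ) * ((1 - r) / (1 + r))) (𝓝[<] 1) (𝓝 0) := by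
  have h0 : ‖τ - (1 : ℝ) * σ‖ ^ 2 ≠ 0 := by
    simpa [sub_eq_zero] using hne
  have : ContinuousAt (fun r : ℝ => poisson τ (r * σ) * ((1 - r) / (1 + r))) 1 := by
    unfold poisson
    refine ContinuousAt.mul (ContinuousAt.div₀ ?_ ?_ h0) (ContinuousAt.div₀ ?_ ?_ (by norm_num)) <;>
      fun_prop
  simpa using this.tendsto.mono_left nhdsWithin_le_nhds

section Atoms

variable {ι : Type*} {σ : ι → ℂ} {c : ι → ℝ}

theorem re_sub_sum_herglotzKernel (hσ : ∀ j, ‖σ j‖ = 1) (G : ℂ → ℂ) (s : Finset ι) (z : ℂ) :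
    (G z - ∑ j ∈ s, c j * herglotzKernel (σ j) z).re =
      (G z).re - ∑ j ∈ s, c j * poisson (σ j) z := by
  simp [Complex.re_sum, re_herglotzKernel (hσ _)]

theorem differentiableOn_sub_sum_herglotzKernel (hσ : ∀ j, ‖σ j‖ = 1) {G : ℂ → ℂ}
    (hG : DifferentiableOn ℂ G disk) (s : Finset ι) :
    DifferentiableOn ℂ (fun z => G z - ∑ j ∈ s, c j * herglotzKernel (σ j) z) disk :=
  hG.sub (DifferentiableOn.fun_sum fun j _ =>
    (differentiableOn_herglotzKernel (hσ j)).const_mul _)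

/-- Lower bounds by Poisson kernels with distinct poles add up. -/
theorem sum_mul_poisson_le_re (hσ : ∀ j, ‖σ j‖ = 1) (hinj : Function.Injective σ) {G : ℂ → ℂ}
    (hG : DifferentiableOn ℂ G disk) (hpos : ∀ z ∈ disk, 0 ≤ (G z).re)
    (hc : ∀ j, ∀ z ∈ disk, c j * poisson (σ j) z ≤ (G z).re) (s : Finset ι) :
    ∀ z ∈ disk, ∑ j ∈ s, c j * poisson (σ j) z ≤ (G z).re := by
  classical
  induction s using Finset.induction_on with
  | empty => simpa using hpos
  | insert k s hk ih =>
    intro z hz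
    -- Along the radius to `σ k`, the other kernels times `(1 - r) / (1 + r)` tend to `0`, so
    -- subtracting them leaves the atom `c k` intact. Julia's lemma applies to the difference, whose
    -- real part is nonnegative by induction.
    have hlim : Tendsto (fun r : ℝ => c k - ∑ j ∈ s,
        c j * (poisson (σ j) (r * σ k) * ((1 - r) / (1 + r)))) (𝓝[<] 1) (𝓝 (c k)) := by
      have : Tendsto (fun r : ℝ => ∑ j ∈ s,
          c j * (poisson (σ j) (r * σ k) * ((1 - r) / (1 + r)))) (𝓝[<] 1)
          (𝓝 (∑ j ∈ s, c j * 0)) := by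
        refine tendsto_finsetSum _ fun j hj => (tendsto_poisson_radial_of_ne ?_).const_mul _
        exact fun h => hk (hinj h ▸ hj)
      simpa using this.const_sub (c k)
    have h := mul_poisson_le_re (differentiableOn_sub_sum_herglotzKernel (c := c) hσ hG s)
      (fun z hz => by
        rw [re_sub_sum_herglotzKernel hσ]
        exact sub_nonneg.2 (ih z hz)) (hσ k) hlim ?_ hz
    · rw [re_sub_sum_herglotzKernel hσ] at h
      rw [Finset.sum_insert hk]
      linarith
    · filter_upwards [eventually_mem_Ioo_zero_one] with r hr
      rw [re_sub_sum_herglotzKernel hσ, sub_mul, Finset.sum_mul]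
      simp only [mul_assoc]
      have h1 := hc k _ (ofReal_mul_mem_disk (hσ k) hr)
      have h2 : 0 ≤ (1 - r) / (1 + r) := div_nonneg (by linarith [hr.2]) (by linarith [hr.1])
      have h3 := mul_le_mul_of_nonneg_right h1 h2
      rw [mul_assoc, poisson_ofReal_mul (hσ k) hr, mul_one] at h3
      linarith

end Atoms

/-- Harnack makes the real part vanish everywhere, and the open mapping theorem excludes a
nonconstant map into the imaginary axis. -/
theorem exists_eq_const_of_re_nonneg {G : ℂ → ℂ} (hG : DifferentiableOn ℂ G disk)
    (hpos : ∀ z ∈ disk, 0 ≤ (G z).re) {z₀ : ℂ} (hz₀ : z₀ ∈ disk) (h0 : (G z₀).re = 0) :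
    ∃ c : ℂ, c.re = 0 ∧ ∀ z ∈ disk, G z = c := by
  have hre : ∀ z ∈ disk, (G z).re = 0 := by
    intro z hz
    have h := harnack_of_re_nonneg hG hpos hz₀ hz
    rw [h0, mul_zero, zero_mul] at h
    have hp : 0 < (1 - ‖z‖ ^ 2) * (1 - ‖z₀‖ ^ 2) :=
      mul_pos (one_sub_norm_sq_pos hz) (one_sub_norm_sq_pos hz₀)
    exact le_antisymm (nonpos_of_mul_nonpos_left h hp) (hpos z hz)
  rcases (hG.analyticOnNhd isOpen_disk).is_constant_or_isOpen
    (convex_ball (0 : ℂ) 1).isPreconnected with ⟨c, hc⟩ | hopen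
  · exact ⟨c, by rw [← hc z₀ hz₀, h0], hc⟩
  · exfalso
    obtain ⟨ε, hε, hball⟩ := Metric.isOpen_iff.1 (hopen disk subset_rfl isOpen_disk) (G z₀)
      ⟨z₀, hz₀, rfl⟩
    have hmem : G z₀ + (ε / 2 : ℝ) ∈ Metric.ball (G z₀) ε := by
      rw [Metric.mem_ball, dist_eq_norm, add_sub_cancel_left, Complex.norm_real,
        Real.norm_of_nonneg (by positivity)]
      linarith
    obtain ⟨z, hz, hzeq⟩ := hball hmem
    have := congrArg Complex.re hzeq
    rw [hre z hz, Complex.add_re, h0, Complex.ofReal_re] at this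
    linarith

/-- If `G` has nonnegative real part and a pole of order at most one at `σ`, with
`G z * (σ - z) → L`, then `L / σ` is real and nonnegative. -/
theorem im_eq_zero_and_re_nonneg_of_tendsto {G : ℂ → ℂ} (hpos : ∀ z ∈ disk, 0 ≤ (G z).re) {σ L : ℂ}
    (hσ : ‖σ‖ = 1) (hL : Tendsto (fun z => G z * (σ - z)) (𝓝[disk] σ) (𝓝 L)) :
    (L / σ).im = 0 ∧ 0 ≤ (L / σ).re := by
  have hσ0 : σ ≠ 0 := by rintro rfl; simp at hσ
  -- Approach `σ` along `σ * (1 - s * v)` with `v = 1 + i t`: there `s * G` has nonnegative real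
  -- part and tends to `L / (σ * v)`. Since `t` is arbitrary, the coefficient of `t` must vanish.
  have key : ∀ t : ℝ, 0 ≤ (L / σ).re + t * (L / σ).im := by
    intro t
    set v : ℂ := ⟨1, t⟩ with hv
    have hvn : ‖v‖ ^ 2 = 1 + t ^ 2 := by
      simp [hv, Complex.sq_norm, Complex.normSq_apply]; ring
    have hv0 : v ≠ 0 := by
      intro h; simp [h] at hvn; nlinarith
    have hdisk : ∀ᶠ s : ℝ in 𝓝[>] 0, σ * (1 - s * v) ∈ disk := by
      have : Set.Ioo (0 : ℝ) (2 / (1 + t ^ 2)) ∈ 𝓝[>] (0 : ℝ) :=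
        Ioo_mem_nhdsGT (by positivity)
      filter_upwards [this] with s hs
      rw [mem_disk_iff, norm_mul, hσ, one_mul]
      have h1 : s * (1 + t ^ 2) < 2 := by
        rw [← lt_div_iff₀ (by positivity)]; exact hs.2
      have h2 : ‖1 - s * v‖ ^ 2 = 1 - 2 * s + s * (s * (1 + t ^ 2)) := by
        simp [hv, Complex.sq_norm, Complex.normSq_apply]; ring
      have h3 : ‖1 - s * v‖ ^ 2 < 1 := by
        rw [h2]; nlinarith [hs.1]
      nlinarith [norm_nonneg (1 - s * v)]
    have hz : Tendsto (fun s : ℝ => σ * (1 - s * v)) (𝓝[>] 0) (𝓝[disk] σ) := by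
      refine tendsto_nhdsWithin_iff.2 ⟨?_, hdisk⟩
      have : Continuous fun s : ℝ => σ * (1 - s * v) := by fun_prop
      simpa using (this.tendsto 0).mono_left nhdsWithin_le_nhds
    have hlim := (Complex.continuous_re.tendsto _).comp ((hL.comp hz).div_const (σ * v))
    have hge : 0 ≤ (L / (σ * v)).re := by
      refine ge_of_tendsto hlim ?_
      filter_upwards [hdisk, self_mem_nhdsWithin] with s hs hs0
      have hs0 : 0 < s := hs0
      have : G (σ * (1 - s * v)) * (σ - σ * (1 - s * v)) / (σ * v) =
          (s : ℝ) * G (σ * (1 - s * v)) := by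
        field_simp
        ring
      simp only [Function.comp_apply]
      rw [this, Complex.re_ofReal_mul]
      exact mul_nonneg hs0.le (hpos _ hs)
    rw [← div_div, Complex.div_re, ← add_div, ← Complex.sq_norm, hvn] at hge
    have := mul_nonneg hge (by positivity : 0 ≤ 1 + t ^ 2)
    rw [div_mul_cancel₀ _ (by positivity)] at this
    simpa [hv, mul_comm] using this
  refine ⟨?_, by simpa using key 0⟩
  by_contra h
  have := key (-((L / σ).re + 1) / (L / σ).im)
  rw [div_mul_cancel₀ _ h] at this
  linarith

/-- The residue at a boundary point gives a Poisson kernel lower bound. -/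
theorem residue_mul_poisson_le_re {G : ℂ → ℂ} (hG : DifferentiableOn ℂ G disk)
    (hpos : ∀ z ∈ disk, 0 ≤ (G z).re) {σ L : ℂ} (hσ : ‖σ‖ = 1)
    (hL : Tendsto (fun z => G z * (σ - z)) (𝓝[disk] σ) (𝓝 L)) {z : ℂ} (hz : z ∈ disk) :
    (L / σ).re / 2 * poisson σ z ≤ (G z).re := by
  have hσ0 : σ ≠ 0 := by rintro rfl; simp at hσ
  have hr : Tendsto (fun r : ℝ => (r : ℂ) * σ) (𝓝[<] 1) (𝓝[disk] σ) := by
    refine tendsto_nhdsWithin_iff.2 ⟨tendsto_ofReal_mul σ, ?_⟩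
    filter_upwards [eventually_mem_Ioo_zero_one] with r hr
    exact ofReal_mul_mem_disk hσ hr
  have hid : Tendsto (fun r : ℝ => r) (𝓝[<] 1) (𝓝 1) := nhdsWithin_le_nhds
  have h1 := ((Complex.continuous_re.tendsto _).comp ((hL.comp hr).div_const σ)).div
    (hid.const_add 1) (by norm_num)
  -- The limit `1 + r → 2` gives the factor `1 / 2`; correspondingly `herglotzKernel σ z * (σ - z) →
  -- 2 * σ`.
  rw [one_add_one_eq_two] at h1
  refine mul_poisson_le_re hG hpos hσ h1 (Eventually.of_forall fun r => le_of_eq ?_) hz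
  have : G (r * σ) * (σ - r * σ) / σ = G (r * σ) * ((1 - r : ℝ) : ℂ) := by
    push_cast
    field_simp
  simp only [Pi.div_apply, Function.comp_apply]
  rw [this, Complex.re_mul_ofReal]
  ring

/-! ### The Herglotz function attached to a self-map with an interior fixed point -/

/-- The Cayley transform of the Schwarz quotient. -/
noncomputable def herglotzFun (f : ℂ → ℂ) (z₀ z : ℂ) : ℂ :=
  (1 + schwarzQuotient f z₀ z) / (1 - schwarzQuotient f z₀ z)

section HerglotzFun

variable {f : ℂ → ℂ} {z₀ : ℂ}

theorem re_herglotzFun (z : ℂ) : (herglotzFun f z₀ z).re =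
    (1 - ‖schwarzQuotient f z₀ z‖ ^ 2) / ‖1 - schwarzQuotient f z₀ z‖ ^ 2 := by
  rw [herglotzFun, re_add_div_sub, norm_one, one_pow]

theorem one_sub_schwarzQuotient_ne_zero (hf : IsHolSelfMap f) (haut : ¬ IsDiskAut f)
    (hz₀ : z₀ ∈ disk) (hfix : f z₀ = z₀) {z : ℂ} (hz : z ∈ disk) :
    1 - schwarzQuotient f z₀ z ≠ 0 :=
  sub_ne_zero_of_mem_disk norm_one ((isHolSelfMap_schwarzQuotient hf haut hz₀ hfix).2 hz)

theorem differentiableOn_herglotzFun (hf : IsHolSelfMap f) (haut : ¬ IsDiskAut f)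
    (hz₀ : z₀ ∈ disk) (hfix : f z₀ = z₀) : DifferentiableOn ℂ (herglotzFun f z₀) disk := by
  have hd := differentiableOn_schwarzQuotient hf hz₀
  exact (hd.const_add 1).div (hd.const_sub 1) fun z hz =>
    one_sub_schwarzQuotient_ne_zero hf haut hz₀ hfix hz

theorem re_herglotzFun_nonneg (hf : IsHolSelfMap f) (hz₀ : z₀ ∈ disk) (hfix : f z₀ = z₀) :
    ∀ z ∈ disk, 0 ≤ (herglotzFun f z₀ z).re := by
  intro z hz
  rw [re_herglotzFun]
  have := norm_schwarzQuotient_le_one hf hz₀ hfix hz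
  exact div_nonneg (by nlinarith [norm_nonneg (schwarzQuotient f z₀ z)]) (by positivity)

/-- The Cayley transform turns dilation bounds for the quotient with target `1` into lower bounds
for `Re F`. -/
theorem schwarzQuotient_dilation_iff (hf : IsHolSelfMap f) (haut : ¬ IsDiskAut f)
    (hz₀ : z₀ ∈ disk) (hfix : f z₀ = z₀) {σ : ℂ} (hσ : ‖σ‖ = 1) {α : ℝ} {z : ℂ} (hz : z ∈ disk) :
    ‖1 - schwarzQuotient f z₀ z‖ ^ 2 * (1 - ‖z‖ ^ 2) ≤
      α * (‖σ - z‖ ^ 2 * (1 - ‖schwarzQuotient f z₀ z‖ ^ 2)) ↔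
    poisson σ z ≤ α * (herglotzFun f z₀ z).re := by
  have h1 := norm_pos_iff.2 (one_sub_schwarzQuotient_ne_zero hf haut hz₀ hfix hz)
  have h2 := norm_pos_iff.2 (sub_ne_zero_of_mem_disk hσ hz)
  rw [re_herglotzFun, poisson, ← mul_div_assoc, div_le_div_iff₀ (by positivity) (by positivity)]
  constructor <;> intro h <;> linarith

/-- At a boundary fixed point, the dilation coefficient is `> 1` and determines the largest
multiple of the Poisson kernel below the real part of the Herglotz function. -/
theorem boundaryDilation_spec (hf : IsHolSelfMap f) (haut : ¬ IsDiskAut f) (hz₀ : z₀ ∈ disk)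
    (hfix : f z₀ = z₀) {σ : ℂ} (hσ : ‖σ‖ = 1) (hβ : boundaryDilation f σ < ⊤)
    (hlim : Tendsto (fun r : ℝ => f (r * σ)) (𝓝[<] 1) (𝓝 σ)) :
    1 < (boundaryDilation f σ).toReal ∧
    (∀ z ∈ disk, 1 / (((boundaryDilation f σ).toReal - 1) * poisson σ z₀) * poisson σ z ≤
      (herglotzFun f z₀ z).re) ∧
    ∀ c : ℝ, (∀ z ∈ disk, c * poisson σ z ≤ (herglotzFun f z₀ z).re) →
      c ≤ 1 / (((boundaryDilation f σ).toReal - 1) * poisson σ z₀) := by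
  rw [boundaryDilation_eq_dilationAt hf hσ hlim] at *
  set β := (dilationAt f σ σ).toReal with hβdef
  have hP := poisson_pos hσ hz₀
  have hb := (dilationAt_le_ofReal_iff hf hσ ENNReal.toReal_nonneg).1
    (ENNReal.ofReal_toReal hβ.ne).ge
  have hF : ∀ z ∈ disk, poisson σ z ≤ (β - 1) * poisson σ z₀ * (herglotzFun f z₀ z).re :=
    fun z hz => (schwarzQuotient_dilation_iff hf haut hz₀ hfix hσ hz).1
      (schwarzQuotient_julia hf haut hz₀ hfix hσ hlim hb hz)
  -- For `β ≤ 1` the bound at `z₀` would make the Poisson kernel nonpositive.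
  have h1 : 1 < β := by
    have h := hF z₀ hz₀
    have h0 := re_herglotzFun_nonneg hf hz₀ hfix z₀ hz₀
    by_contra hcon
    have : (β - 1) * poisson σ z₀ * (herglotzFun f z₀ z₀).re ≤ 0 :=
      mul_nonpos_of_nonpos_of_nonneg (mul_nonpos_of_nonpos_of_nonneg (by linarith) hP.le) h0
    linarith
  have hβ1 : 0 < (β - 1) * poisson σ z₀ := mul_pos (by linarith) hP
  refine ⟨h1, fun z hz => ?_, fun c hc => ?_⟩
  · rw [one_div_mul_eq_div, div_le_iff₀' hβ1]
    exact hF z hz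
  · rcases le_or_gt c 0 with hc0 | hc0
    · exact hc0.trans (by positivity)
    -- This number is the `γ` solving `c = 1 / ((γ - 1) * poisson σ z₀)`; the converse transfer
    -- shows that it bounds the dilation of `f`.
    have hγ : 0 ≤ 1 + 1 / (c * poisson σ z₀) := by positivity
    have hle : dilationAt f σ σ ≤ ENNReal.ofReal (1 + 1 / (c * poisson σ z₀)) := by
      refine (dilationAt_le_ofReal_iff hf hσ hγ).2 fun z hz =>
        dilation_le_of_schwarzQuotient hf haut hz₀ hfix hσ hlim (fun w hw => ?_) hz
      rw [schwarzQuotient_dilation_iff hf haut hz₀ hfix hσ hw]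
      have e : (1 + 1 / (c * poisson σ z₀) - 1) * poisson σ z₀ = 1 / c := by
        field_simp
        ring
      rw [e, one_div_mul_eq_div, le_div_iff₀' hc0]
      exact hc w hw
    have hβle : β ≤ 1 + 1 / (c * poisson σ z₀) := ENNReal.toReal_le_of_le_ofReal hγ hle
    rw [le_div_iff₀ hβ1]
    have h3 : (β - 1) * (c * poisson σ z₀) ≤ 1 := by
      rw [← le_div_iff₀ (by positivity)]
      linarith
    linarith

end HerglotzFun

/-! ### Reflection of polynomials in the unit circle -/

/-- `u * B` is the conjugate-reciprocal of `A`, regarded as a polynomial of degree `d`. -/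
def IsReflection (d : ℕ) (u : ℂ) (A B : ℂ[X]) : Prop :=
  ∀ z : ℂ, z ≠ 0 → z ^ d * conj (A.eval (conj z)⁻¹) = u * B.eval z

theorem eq_of_eval_eq_of_ne_zero {A B : ℂ[X]} (h : ∀ z : ℂ, z ≠ 0 → A.eval z = B.eval z) :
    A = B := by
  refine Polynomial.eq_of_infinite_eval_eq A B (Set.Infinite.mono (s := {0}ᶜ) (fun z hz => h z hz) ?_)
  exact (Set.finite_singleton 0).infinite_compl

theorem exists_isReflection {n : ℕ} {u : ℂ} (hu : u ≠ 0) {p : ℂ[X]} (hp : p.natDegree ≤ n) :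
    ∃ b : ℂ[X], b.natDegree ≤ n ∧ IsReflection n u p b := by
  refine ⟨C u⁻¹ * (p.reflect n).map (starRingEnd ℂ), ?_, fun z hz => ?_⟩
  · refine (natDegree_C_mul_le _ _).trans (natDegree_map_le.trans ?_)
    exact natDegree_reflect_le.trans (max_le le_rfl hp)
  · have hz' : z⁻¹ ≠ 0 := inv_ne_zero hz
    let _ := invertibleOfNonzero hz'
    have h := Polynomial.eval₂_reflect_mul_pow (starRingEnd ℂ) z⁻¹ n p hp
    rw [invOf_eq_inv, inv_inv] at h
    have h2 : conj (p.eval (conj z)⁻¹) = p.eval₂ (starRingEnd ℂ) z⁻¹ := by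
      rw [← Polynomial.eval₂_at_apply]
      simp
    rw [h2, ← h, Polynomial.eval_mul, Polynomial.eval_C, Polynomial.eval_map, mul_inv_cancel_left₀ hu,
      mul_left_comm, ← mul_pow, mul_inv_cancel₀ hz, one_pow, mul_one]

theorem conj_inv_of_norm_eq_one {z : ℂ} (hz : ‖z‖ = 1) : (conj z)⁻¹ = z := by
  rw [Complex.inv_def, Complex.conj_conj, Complex.normSq_conj, Complex.normSq_eq_norm_sq, hz]
  simp

theorem conj_mul_self_of_norm_eq_one {z : ℂ} (hz : ‖z‖ = 1) : conj z * z = 1 := by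
  rw [Complex.conj_mul', hz]; simp

theorem IsReflection.norm_eq {d : ℕ} {u : ℂ} {A B : ℂ[X]} (h : IsReflection d u A B) (hu : ‖u‖ = 1)
    {z : ℂ} (hz : ‖z‖ = 1) : ‖B.eval z‖ = ‖A.eval z‖ := by
  have := congrArg norm (h z (by rintro rfl; simp at hz))
  rw [conj_inv_of_norm_eq_one hz, norm_mul, norm_mul, norm_pow, hz, hu, Complex.norm_conj] at this
  simpa using this.symm

theorem exists_eval_eq_prod_sub {A : ℂ[X]} (hA : A ≠ 0) :
    ∃ (c : ℂ) (a : Fin A.natDegree → ℂ), c ≠ 0 ∧ ∀ z, A.eval z = c * ∏ k, (z - a k) := by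
  have hs : A.Splits := IsAlgClosed.splits A
  have hcard : A.roots.toList.length = A.natDegree := by
    rw [Multiset.length_toList, ← hs.natDegree_eq_card_roots]
  rw [← hcard]
  refine ⟨A.leadingCoeff, fun k => A.roots.toList[k.1], leadingCoeff_ne_zero.2 hA, fun z => ?_⟩
  rw [Fin.prod_univ_fun_getElem A.roots.toList (fun a => z - a), hs.eval_eq_prod_roots,
    ← Multiset.prod_coe, ← Multiset.map_coe, Multiset.coe_toList]

/-- Factoring `A` over its roots and reflecting writes `B` as a constant times `z ^ (d - m) * ∏ (1 -
conj (a k) * z)`. Then `B 0 ≠ 0` forces `m = d`, and the absence of zeros of `B` in the closed disk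
puts every `a k` in the open disk. -/
theorem isBlaschkeProduct_of_isReflection {d : ℕ} {u : ℂ} (hu : ‖u‖ = 1) {A B : ℂ[X]}
    (hdeg : A.natDegree ≤ d) (hAB : IsReflection d u A B)
    (hB : ∀ z : ℂ, ‖z‖ ≤ 1 → B.eval z ≠ 0) {f : ℂ → ℂ}
    (hf : ∀ z ∈ disk, f z = A.eval z / B.eval z) : IsBlaschkeProduct d f := by
  have hu0 : u ≠ 0 := by rintro rfl; simp at hu
  have hA : A ≠ 0 := by
    rintro rfl
    have := hAB 1 one_ne_zero
    simp [hu0] at this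
    exact hB 1 (by simp) this
  obtain ⟨c, a, hc, ha⟩ := exists_eval_eq_prod_sub hA
  generalize A.natDegree = m at a ha hdeg
  have hrefl : ∀ z : ℂ, u * B.eval z = z ^ (d - m) * (conj c * ∏ k, (1 - conj (a k) * z)) := by
    have hne : ∀ z : ℂ, z ≠ 0 →
        u * B.eval z = z ^ (d - m) * (conj c * ∏ k, (1 - conj (a k) * z)) := by
      intro z hz
      have hp : ∏ k, (1 - conj (a k) * z) = z ^ m * ∏ k, conj ((conj z)⁻¹ - a k) := by
        have : (z ^ m : ℂ) = ∏ _k : Fin m, z := by simp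
        rw [this, ← Finset.prod_mul_distrib]
        refine Finset.prod_congr rfl fun k _ => ?_
        simp only [map_sub, map_inv₀, Complex.conj_conj, mul_sub, mul_inv_cancel₀ hz]
        ring
      rw [← hAB z hz, ha, map_mul, map_prod, hp]
      nth_rw 1 [← Nat.sub_add_cancel hdeg]
      rw [pow_add]
      ring
    have h := Continuous.ext_on (dense_compl_singleton (0 : ℂ))
      (f := fun z => u * B.eval z)
      (g := fun z => z ^ (d - m) * (conj c * ∏ k, (1 - conj (a k) * z)))
      (by fun_prop) (by fun_prop) (fun z hz => hne z hz)
    exact fun z => congrFun h z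
  have hmd : m = d := by
    refine le_antisymm hdeg (not_lt.1 fun hlt => ?_)
    have := hrefl 0
    rw [zero_pow (by omega), zero_mul] at this
    exact mul_ne_zero hu0 (hB 0 (by simp)) this
  subst hmd
  simp only [Nat.sub_self, pow_zero, one_mul] at hrefl
  have hcc : ‖u * (c / conj c)‖ = 1 := by
    rw [norm_mul, hu, norm_div, Complex.norm_conj, div_self (norm_ne_zero_iff.2 hc), one_mul]
  refine ⟨(u * (c / conj c)).arg, a, fun k => ?_, fun z hz => ?_⟩
  · rw [mem_disk_iff]
    by_contra hk
    rw [not_lt] at hk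
    have hk0 : a k ≠ 0 := by
      intro h; rw [h] at hk; simp at hk; linarith
    have hz : ‖(conj (a k))⁻¹‖ ≤ 1 := by
      rw [norm_inv, Complex.norm_conj]
      exact inv_le_one_of_one_le₀ hk
    refine mul_ne_zero hu0 (hB _ hz) ?_
    rw [hrefl, Finset.prod_eq_zero (Finset.mem_univ k), mul_zero]
    rw [mul_inv_cancel₀ (by simpa using hk0), sub_self]
  · have h1 := Complex.norm_mul_exp_arg_mul_I (u * (c / conj c))
    rw [hcc, Complex.ofReal_one, one_mul, mul_comm] at h1
    rw [h1, hf z hz, Finset.prod_div_distrib, ha]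
    have h2 := hrefl z
    have hBz := hB z (mem_disk_iff.1 hz).le
    have hcc0 : conj c ≠ 0 := by simpa using hc
    have h3 : ∏ k, (1 - conj (a k) * z) ≠ 0 := by
      intro h
      rw [h, mul_zero] at h2
      exact mul_ne_zero hu0 hBz h2
    rw [div_eq_iff hBz]
    have h4 : B.eval z = conj c * (∏ k, (1 - conj (a k) * z)) / u := by
      rw [← h2, mul_div_cancel_left₀ _ hu0]
    rw [h4]
    generalize ∏ k, (1 - conj (a k) * z) = Q at h3 ⊢
    field_simp

/-- Together with `IsReflection.one_sub_C_mul`: multiplying `A / B` by a Blaschke factor preserves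
reflected pairs. -/
theorem IsReflection.X_sub_C_mul {d : ℕ} {u a : ℂ} {A B : ℂ[X]} (h : IsReflection d u A B) :
    IsReflection (d + 1) u ((X - C a) * A) ((1 - C (conj a) * X) * B) := by
  intro z hz
  have := h z hz
  simp only [eval_mul, eval_sub, eval_X, eval_C, eval_one, map_mul, map_sub, map_inv₀,
    Complex.conj_conj]
  calc _ = (z * z⁻¹ - conj a * z) * (z ^ d * conj (A.eval (conj z)⁻¹)) := by ring
    _ = _ := by rw [this, mul_inv_cancel₀ hz]; ring

theorem IsReflection.one_sub_C_mul {d : ℕ} {u a : ℂ} {A B : ℂ[X]} (h : IsReflection d u A B) :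
    IsReflection (d + 1) u ((1 - C (conj a) * X) * A) ((X - C a) * B) := by
  intro z hz
  have := h z hz
  simp only [eval_mul, eval_sub, eval_X, eval_C, eval_one, map_mul, map_sub, map_inv₀, map_one,
    Complex.conj_conj]
  calc _ = (z - a * (z * z⁻¹)) * (z ^ d * conj (A.eval (conj z)⁻¹)) := by ring
    _ = _ := by rw [this, mul_inv_cancel₀ hz]; ring

/-- On quotients `A / B` this is post-composition with `mobius (-a)`. -/
theorem IsReflection.add_C_mul {d : ℕ} {u a : ℂ} {A B : ℂ[X]} (h : IsReflection d u A B)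
    (h' : IsReflection d u B A) :
    IsReflection d u (A + C a * B) (B + C (conj a) * A) := by
  intro z hz
  simp only [eval_add, eval_mul, eval_C, map_add, map_mul]
  linear_combination h z hz + conj a * h' z hz

theorem exists_eq_C_mul_prod_of_forall_eval_eq_zero {n : ℕ} {σ : Fin n → ℂ} (hinj : Function.Injective σ)
    {P : ℂ[X]} (hP : P.natDegree ≤ n) (h0 : ∀ j, P.eval (σ j) = 0) :
    ∃ κ : ℂ, P = C κ * ∏ j, (X - C (σ j)) := by
  have hdvd : ∏ j, (X - C (σ j)) ∣ P := by
    refine Finset.prod_dvd_of_coprime (fun i _ j _ hij => ?_) fun j _ => dvd_iff_isRoot.2 (h0 j)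
    exact Polynomial.pairwise_coprime_X_sub_C hinj hij
  obtain ⟨S, hS⟩ := hdvd
  have hmon : (∏ j, (X - C (σ j))).Monic := monic_prod_of_monic _ _ fun j _ => monic_X_sub_C _
  have hd : (∏ j, (X - C (σ j))).natDegree = n := by
    rw [natDegree_prod_of_monic _ _ fun j _ => monic_X_sub_C _]
    simp
  have hS0 : S.natDegree = 0 := by
    have := hmon.natDegree_mul' (q := S)
    by_cases hS' : S = 0
    · simp [hS']
    · have h1 := this hS'
      rw [← hS, hd] at h1
      omega
  refine ⟨S.coeff 0, ?_⟩
  rw [← eq_C_of_natDegree_eq_zero hS0, hS, mul_comm]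

/-! ### Polynomials attached to a finite sum of Herglotz kernels -/

section KernelPolynomials

variable {n : ℕ}

/-- The common denominator of the Herglotz kernels with poles `σ j`. -/
noncomputable def poleDenominator (σ : Fin n → ℂ) : ℂ[X] := ∏ j, (C (σ j) - X)

/-- The numerator of `w + ∑ j, c j * herglotzKernel (σ j) z` over `poleDenominator σ`. -/
noncomputable def kernelNumerator (σ : Fin n → ℂ) (c : Fin n → ℝ) (w : ℂ) : ℂ[X] :=
  C w * poleDenominator σ +
    ∑ j, C (c j : ℂ) * ((C (σ j) + X) * ∏ i ∈ Finset.univ.erase j, (C (σ i) - X))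

variable {σ : Fin n → ℂ} {c : Fin n → ℝ} {w : ℂ}

theorem eval_poleDenominator (z : ℂ) : (poleDenominator σ).eval z = ∏ j, (σ j - z) := by
  simp [poleDenominator, eval_prod]

theorem eval_kernelNumerator (z : ℂ) : (kernelNumerator σ c w).eval z =
    w * ∏ j, (σ j - z) +
      ∑ j, c j * ((σ j + z) * ∏ i ∈ Finset.univ.erase j, (σ i - z)) := by
  simp [kernelNumerator, eval_prod, eval_finsetSum, eval_poleDenominator]

theorem eval_kernelNumerator_of_ne {z : ℂ} (hz : ∀ j, σ j ≠ z) :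
    (kernelNumerator σ c w).eval z =
      (w + ∑ j, c j * herglotzKernel (σ j) z) * (poleDenominator σ).eval z := by
  rw [eval_kernelNumerator, eval_poleDenominator, add_mul, Finset.sum_mul]
  congr 1
  refine Finset.sum_congr rfl fun j _ => ?_
  rw [← Finset.mul_prod_erase _ _ (Finset.mem_univ j), herglotzKernel]
  have := sub_ne_zero.2 (hz j)
  field_simp

theorem eval_kernelNumerator_self (k : Fin n) : (kernelNumerator σ c w).eval (σ k) =
    c k * ((σ k + σ k) * ∏ i ∈ Finset.univ.erase k, (σ i - σ k)) := by
  rw [eval_kernelNumerator, Finset.prod_eq_zero (Finset.mem_univ k) (sub_self _), mul_zero,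
    zero_add]
  refine Finset.sum_eq_single k (fun j _ hj => ?_) (by simp)
  rw [Finset.prod_eq_zero (i := k) (by simp [hj.symm]) (sub_self _), mul_zero, mul_zero]

theorem natDegree_C_sub_X_le (a : ℂ) : (C a - X : ℂ[X]).natDegree ≤ 1 :=
  (natDegree_sub_le _ _).trans (by simp)

theorem natDegree_prod_C_sub_X_le (s : Finset (Fin n)) :
    (∏ i ∈ s, (C (σ i) - X)).natDegree ≤ s.card := by
  refine (natDegree_prod_le _ _).trans ?_
  simpa using Finset.sum_le_card_nsmul s _ 1 fun i _ => natDegree_C_sub_X_le (σ i)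

theorem natDegree_poleDenominator_le : (poleDenominator σ).natDegree ≤ n := by
  simpa [poleDenominator] using natDegree_prod_C_sub_X_le (σ := σ) Finset.univ

theorem natDegree_kernelNumerator_le : (kernelNumerator σ c w).natDegree ≤ n := by
  refine natDegree_add_le_of_degree_le ((natDegree_C_mul_le _ _).trans
    natDegree_poleDenominator_le) (natDegree_sum_le_of_forall_le _ _ fun j _ => ?_)
  refine (natDegree_C_mul_le _ _).trans (natDegree_mul_le.trans ?_)
  have h1 : (C (σ j) + X : ℂ[X]).natDegree ≤ 1 := (natDegree_add_le _ _).trans (by simp)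
  have h2 := natDegree_prod_C_sub_X_le (σ := σ) (Finset.univ.erase j)
  rw [Finset.card_erase_of_mem (Finset.mem_univ j), Finset.card_univ, Fintype.card_fin] at h2
  have := j.pos
  omega

theorem mul_conj_sub_inv {a z : ℂ} (ha : ‖a‖ = 1) (hz : z ≠ 0) :
    z * conj (a - (conj z)⁻¹) = -conj a * (a - z) := by
  have h := conj_mul_self_of_norm_eq_one ha
  simp only [map_sub, map_inv₀, Complex.conj_conj, mul_sub, mul_inv_cancel₀ hz]
  linear_combination h

theorem mul_conj_add_inv {a z : ℂ} (ha : ‖a‖ = 1) (hz : z ≠ 0) :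
    z * conj (a + (conj z)⁻¹) = conj a * (a + z) := by
  have h := conj_mul_self_of_norm_eq_one ha
  simp only [map_add, map_inv₀, Complex.conj_conj, mul_add, mul_inv_cancel₀ hz]
  linear_combination -h

theorem isReflection_poleDenominator (hσ : ∀ j, ‖σ j‖ = 1) :
    IsReflection n (∏ j, -conj (σ j)) (poleDenominator σ) (poleDenominator σ) := by
  intro z hz
  rw [eval_poleDenominator, eval_poleDenominator, map_prod, ← Finset.prod_mul_distrib]
  have : (z ^ n : ℂ) = ∏ _j : Fin n, z := by simp
  rw [this, ← Finset.prod_mul_distrib]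
  exact Finset.prod_congr rfl fun j _ => mul_conj_sub_inv (hσ j) hz

/-- The sign reflects that `w + ∑ c_j H_{σ_j}` is imaginary on the unit circle away from its poles.
-/
theorem isReflection_kernelNumerator (hσ : ∀ j, ‖σ j‖ = 1) (hw : w.re = 0) :
    IsReflection n (∏ j, -conj (σ j)) (kernelNumerator σ c w) (-kernelNumerator σ c w) := by
  intro z hz
  have h0 := isReflection_poleDenominator hσ z hz
  have hwc : conj w = -w := by
    apply Complex.ext <;> simp [hw]
  rw [eval_poleDenominator, eval_poleDenominator] at h0
  rw [eval_neg, eval_kernelNumerator, eval_kernelNumerator, map_add, map_mul, hwc, map_sum,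
    mul_add, neg_add, mul_add, Finset.mul_sum, ← Finset.sum_neg_distrib, Finset.mul_sum]
  refine congrArg₂ (· + ·) (by linear_combination (-w) * h0) (Finset.sum_congr rfl fun j _ => ?_)
  have hpow : (z ^ n : ℂ) = z * ∏ _i ∈ Finset.univ.erase j, z := by
    rw [Finset.mul_prod_erase _ (fun _ => z) (Finset.mem_univ j)]
    simp
  have hprod : (∏ _i ∈ Finset.univ.erase j, z) *
      conj (∏ i ∈ Finset.univ.erase j, (σ i - (conj z)⁻¹)) =
      (∏ i ∈ Finset.univ.erase j, -conj (σ i)) * ∏ i ∈ Finset.univ.erase j, (σ i - z) := by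
    rw [map_prod, ← Finset.prod_mul_distrib, ← Finset.prod_mul_distrib]
    exact Finset.prod_congr rfl fun i _ => mul_conj_sub_inv (hσ i) hz
  rw [← Finset.mul_prod_erase _ (fun i => -conj (σ i)) (Finset.mem_univ j), hpow, map_mul, map_mul,
    Complex.conj_ofReal]
  calc _ = c j * (z * conj (σ j + (conj z)⁻¹)) * ((∏ _i ∈ Finset.univ.erase j, z) *
      conj (∏ i ∈ Finset.univ.erase j, (σ i - (conj z)⁻¹))) := by ring
    _ = _ := by rw [mul_conj_add_inv (hσ j) hz, hprod]; ring

/-- Off the poles the two polynomials are `(S ± 1)` times the denominator, with `Re S ≥ 0`. At a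
pole the denominator vanishes but the numerator does not, because `c k > 0`. -/
theorem kernelNumerator_add_sub_spec (hσ : ∀ j, ‖σ j‖ = 1) (hinj : Function.Injective σ)
    (hc : ∀ j, 0 < c j) (hw : w.re = 0) {z : ℂ} (hz : ‖z‖ ≤ 1) :
    (kernelNumerator σ c w + poleDenominator σ).eval z ≠ 0 ∧
    ‖(kernelNumerator σ c w - poleDenominator σ).eval z‖ ≤
      ‖(kernelNumerator σ c w + poleDenominator σ).eval z‖ := by
  simp only [eval_add, eval_sub]
  by_cases h : ∀ j, σ j ≠ z
  · have hD : (poleDenominator σ).eval z ≠ 0 := by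
      rw [eval_poleDenominator]
      exact Finset.prod_ne_zero_iff.2 fun j _ => sub_ne_zero.2 (h j)
    rw [eval_kernelNumerator_of_ne h]
    set S := w + ∑ j, c j * herglotzKernel (σ j) z with hS
    have hre : 0 ≤ S.re := by
      have : S.re = ∑ j, c j * poisson (σ j) z := by
        simp [hS, hw, Complex.re_sum, re_herglotzKernel (hσ _)]
      rw [this]
      refine Finset.sum_nonneg fun j _ => mul_nonneg (hc j).le ?_
      exact div_nonneg (by nlinarith [norm_nonneg z]) (by positivity)
    have h1 : S * (poleDenominator σ).eval z + (poleDenominator σ).eval z =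
      (S + 1) * (poleDenominator σ).eval z := by ring
    have h2 : S * (poleDenominator σ).eval z - (poleDenominator σ).eval z =
      (S - 1) * (poleDenominator σ).eval z := by ring
    rw [h1, h2, norm_mul, norm_mul]
    refine ⟨mul_ne_zero (add_one_ne_zero_of_re_nonneg hre) hD, ?_⟩
    gcongr
    have := norm_sub_one_sq_add S
    nlinarith [norm_nonneg (S - 1), norm_nonneg (S + 1)]
  · push Not at h
    obtain ⟨k, rfl⟩ := h
    have hD : (poleDenominator σ).eval (σ k) = 0 := by
      rw [eval_poleDenominator]
      exact Finset.prod_eq_zero (Finset.mem_univ k) (sub_self _)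
    rw [hD, add_zero, sub_zero, eval_kernelNumerator_self]
    refine ⟨?_, le_rfl⟩
    have hk : σ k ≠ 0 := by
      intro h; have := hσ k; rw [h] at this; simp at this
    refine mul_ne_zero (by exact_mod_cast (hc k).ne') (mul_ne_zero ?_ ?_)
    · rw [← two_mul]; exact mul_ne_zero two_ne_zero hk
    · refine Finset.prod_ne_zero_iff.2 fun i hi => sub_ne_zero.2 fun h => ?_
      exact (Finset.mem_erase.1 hi).1 (hinj h)

end KernelPolynomials

/-! ### Equality forces a Blaschke product -/

theorem schwarzQuotient_eq_of_herglotzFun {f : ℂ → ℂ} {z₀ z F : ℂ}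
    (h1 : 1 - schwarzQuotient f z₀ z ≠ 0) (hF : herglotzFun f z₀ z = F) :
    schwarzQuotient f z₀ z * (F + 1) = F - 1 := by
  rw [← hF, herglotzFun]
  field_simp
  ring

/-- Undo `mobius z₀` by post-composing with `mobius (-z₀)`; the new denominator has no zero in the
closed disk because `|z₀| < 1` and `|A| ≤ |B|`. -/
theorem isBlaschkeProduct_of_mobius_eq {f : ℂ → ℂ} (hf : IsHolSelfMap f) {z₀ : ℂ} (hz₀ : z₀ ∈ disk)
    {d : ℕ} {u : ℂ} (hu : ‖u‖ = 1) {A B : ℂ[X]} (hA : A.natDegree ≤ d) (hB : B.natDegree ≤ d)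
    (hAB : IsReflection d u A B) (hBA : IsReflection d u B A)
    (hB0 : ∀ z : ℂ, ‖z‖ ≤ 1 → B.eval z ≠ 0)
    (hle : ∀ z : ℂ, ‖z‖ ≤ 1 → ‖A.eval z‖ ≤ ‖B.eval z‖)
    (h : ∀ z ∈ disk, mobius z₀ (f z) = A.eval z / B.eval z) : IsBlaschkeProduct d f := by
  have hM0 : ∀ z : ℂ, ‖z‖ ≤ 1 → (B + C (conj z₀) * A).eval z ≠ 0 := by
    intro z hz h0
    rw [eval_add, eval_mul, eval_C] at h0
    have h1 : ‖B.eval z‖ = ‖z₀‖ * ‖A.eval z‖ := by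
      rw [eq_neg_of_add_eq_zero_left h0, norm_neg, norm_mul, Complex.norm_conj]
    have h2 := norm_pos_iff.2 (hB0 z hz)
    have h3 := mem_disk_iff.1 hz₀
    nlinarith [hle z hz, norm_nonneg (A.eval z), norm_nonneg z₀]
  refine isBlaschkeProduct_of_isReflection hu
    (natDegree_add_le_of_degree_le hA ((natDegree_C_mul_le _ _).trans hB))
    (hAB.add_C_mul (a := z₀) hBA) hM0 fun z hz => ?_
  have hz1 := (mem_disk_iff.1 hz).le
  have hM := hM0 z hz1
  have hBz := hB0 z hz1
  rw [← mobius_neg_mobius hz₀ (mem_disk_iff.1 (hf.2 hz)).le, h z hz, mobius]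
  simp only [eval_add, eval_mul, eval_C, map_neg, sub_neg_eq_add, neg_mul] at hM ⊢
  rw [← mul_div_assoc, ← mul_div_mul_right _ _ hBz, add_mul, add_mul, div_mul_cancel₀ _ hBz,
    div_mul_cancel₀ _ hBz, one_mul]

/-- Solving `F = E / D` gives `q = (E - D) / (E + D)` with degrees at most `n`; the factor `mobius
z₀ z` raises the bound to `n + 1`. -/
theorem isBlaschkeProduct_of_herglotzFun_eq {f : ℂ → ℂ} (hf : IsHolSelfMap f)
    (haut : ¬ IsDiskAut f) {z₀ : ℂ} (hz₀ : z₀ ∈ disk) (hfix : f z₀ = z₀) {n : ℕ} {σ : Fin n → ℂ}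
    (hσ : ∀ j, ‖σ j‖ = 1) (hinj : Function.Injective σ) {c : Fin n → ℝ} (hc : ∀ j, 0 < c j)
    {w : ℂ} (hw : w.re = 0)
    (h : ∀ z ∈ disk, herglotzFun f z₀ z = w + ∑ j, c j * herglotzKernel (σ j) z) :
    IsBlaschkeProduct (n + 1) f := by
  set E := kernelNumerator σ c w
  set D := poleDenominator σ
  set κ : ℂ := ∏ j, -conj (σ j)
  have hD : IsReflection n κ D D := isReflection_poleDenominator hσ
  have hE : IsReflection n κ E (-E) := isReflection_kernelNumerator hσ hw
  have hκ : ‖-κ‖ = 1 := by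
    rw [norm_neg, norm_prod]
    exact Finset.prod_eq_one fun j _ => by rw [norm_neg, Complex.norm_conj, hσ j]
  have hpb : IsReflection n (-κ) (E - D) (E + D) := by
    intro z hz
    have h1 := hD z hz
    have h2 := hE z hz
    simp only [eval_add, eval_sub, eval_neg, map_sub] at *
    linear_combination h2 - h1
  have hbp : IsReflection n (-κ) (E + D) (E - D) := by
    intro z hz
    have h1 := hD z hz
    have h2 := hE z hz
    simp only [eval_add, eval_sub, eval_neg, map_add] at *
    linear_combination h2 + h1
  have hspec := fun (z : ℂ) (hz : ‖z‖ ≤ 1) =>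
    kernelNumerator_add_sub_spec (w := w) hσ hinj hc hw hz
  have hEdeg : E.natDegree ≤ n := natDegree_kernelNumerator_le
  have hDdeg : D.natDegree ≤ n := natDegree_poleDenominator_le
  have h1X : (1 - C (conj z₀) * X : ℂ[X]).natDegree ≤ 1 :=
    (natDegree_sub_le _ _).trans (by simpa using natDegree_C_mul_le (conj z₀) X)
  have hsub : (E - D).natDegree ≤ n := (natDegree_sub_le _ _).trans (max_le hEdeg hDdeg)
  have hadd : (E + D).natDegree ≤ n := natDegree_add_le_of_degree_le hEdeg hDdeg
  refine isBlaschkeProduct_of_mobius_eq hf hz₀ hκ (A := (X - C z₀) * (E - D))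
    (B := (1 - C (conj z₀) * X) * (E + D)) ?_ ?_ hpb.X_sub_C_mul hbp.one_sub_C_mul
    (fun z hz => ?_) (fun z hz => ?_) (fun z hz => ?_)
  · refine natDegree_mul_le.trans ?_
    rw [natDegree_X_sub_C]
    omega
  · exact natDegree_mul_le.trans (by omega)
  · rw [eval_mul]
    exact mul_ne_zero (by simpa using one_sub_conj_mul_ne_zero hz₀ hz) (hspec z hz).1
  · rw [eval_mul, eval_mul, norm_mul, norm_mul]
    refine mul_le_mul ?_ (hspec z hz).2 (norm_nonneg _) (norm_nonneg _)
    have h1 := norm_one_sub_conj_mul_sq z₀ z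
    have h2 : 0 ≤ (1 - ‖z₀‖ ^ 2) * (1 - ‖z‖ ^ 2) :=
      mul_nonneg (one_sub_norm_sq_pos hz₀).le (by nlinarith [norm_nonneg z])
    simp only [eval_sub, eval_X, eval_C, eval_one, eval_mul]
    exact le_of_sq_le_sq (by linarith) (norm_nonneg _)
  · have hz1 := (mem_disk_iff.1 hz).le
    have hne : ∀ j, σ j ≠ z := fun j => sub_ne_zero.1 (sub_ne_zero_of_mem_disk (hσ j) hz)
    have hq := schwarzQuotient_eq_of_herglotzFun
      (one_sub_schwarzQuotient_ne_zero hf haut hz₀ hfix hz) (h z hz)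
    have hEz : E.eval z = _ := eval_kernelNumerator_of_ne (c := c) (w := w) hne
    have hb := (hspec z hz1).1
    rw [← mobius_mul_schwarzQuotient hz₀ hfix hz]
    have hqe : schwarzQuotient f z₀ z = (E - D).eval z / (E + D).eval z := by
      rw [eq_div_iff hb, eval_add, eval_sub, hEz]
      linear_combination D.eval z * hq
    rw [hqe, mobius, div_mul_div_comm]
    simp

/-! ### Blaschke products give equality -/

theorem exists_mem_sphere_forall_ne {n : ℕ} (σ : Fin n → ℂ) : ∃ ζ : ℂ, ‖ζ‖ = 1 ∧ ∀ j, σ j ≠ ζ := by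
  have hinf : (Metric.sphere (0 : ℂ) 1).Infinite := by
    have h : Set.InjOn (fun t : ℝ => Complex.exp (t * I)) (Set.Icc 0 1) := by
      intro s hs t ht hst
      simp only [Complex.exp_eq_exp_iff_exists_int] at hst
      obtain ⟨k, hk⟩ := hst
      have h1 : s = t + k * (2 * Real.pi) := by
        have := congrArg Complex.im hk
        simpa using this
      have hk0 : k = 0 := by
        have hpi := Real.pi_gt_three
        by_contra hk0
        rcases lt_or_gt_of_ne hk0 with hlt | hgt
        · have : (k : ℝ) ≤ -1 := by exact_mod_cast Int.le_sub_one_of_lt hlt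
          nlinarith [hs.1, hs.2, ht.1, ht.2]
        · have : (1 : ℝ) ≤ k := by exact_mod_cast hgt
          nlinarith [hs.1, hs.2, ht.1, ht.2]
      simpa [hk0] using h1
    refine ((Set.Icc_infinite (zero_lt_one (α := ℝ))).image h).mono ?_
    rintro _ ⟨t, _, rfl⟩
    simp [Complex.norm_exp_ofReal_mul_I]
  obtain ⟨ζ, hζ, hζσ⟩ := hinf.exists_notMem_finite (Set.finite_range σ)
  exact ⟨ζ, by simpa using hζ, fun j hj => hζσ ⟨j, hj⟩⟩

/-- The Schwarz quotient of a Blaschke product of degree `n + 1` is a quotient of polynomials of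
degree at most `n` reflected into each other. -/
theorem IsBlaschkeProduct.exists_schwarzQuotient {f : ℂ → ℂ} {n : ℕ} (hB : IsBlaschkeProduct (n + 1) f)
    (hf : IsHolSelfMap f) {z₀ : ℂ} (hz₀ : z₀ ∈ disk) (hfix : f z₀ = z₀) :
    ∃ p b : ℂ[X], p.natDegree ≤ n ∧ b.natDegree ≤ n ∧ (∀ z : ℂ, ‖z‖ = 1 → ‖b.eval z‖ = ‖p.eval z‖) ∧
      ∀ z ∈ disk, b.eval z ≠ 0 ∧ schwarzQuotient f z₀ z * b.eval z = p.eval z := by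
  obtain ⟨θ, a, ha, hfa⟩ := hB
  set u : ℂ := Complex.exp (I * θ) with hu_def
  have hu : ‖u‖ = 1 := by rw [hu_def, mul_comm, Complex.norm_exp_ofReal_mul_I]
  have hcu : ‖conj u‖ = 1 := by rwa [Complex.norm_conj]
  have hcu0 : conj u ≠ 0 := norm_ne_zero_iff.1 (by rw [hcu]; exact one_ne_zero)
  have huu : conj u * u = 1 := conj_mul_self_of_norm_eq_one hu
  set P₀ : ℂ[X] := ∏ j, (X - C (a j)) with hP₀
  set Q : ℂ[X] := ∏ j, (1 - C (conj (a j)) * X) with hQ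
  have hPQ : IsReflection (n + 1) (conj u) (C u * P₀) Q ∧
      IsReflection (n + 1) (conj u) Q (C u * P₀) := by
    have key : ∀ (m : ℕ) (a : Fin m → ℂ),
        IsReflection m 1 (∏ j, (X - C (a j))) (∏ j, (1 - C (conj (a j)) * X)) ∧
        IsReflection m 1 (∏ j, (1 - C (conj (a j)) * X)) (∏ j, (X - C (a j))) := by
      intro m
      induction m with
      | zero => intro a; constructor <;> intro z _ <;> simp
      | succ m ih =>
        intro a
        simp only [Fin.prod_univ_succ]
        exact ⟨(ih _).1.X_sub_C_mul, (ih _).2.one_sub_C_mul⟩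
    obtain ⟨h1, h2⟩ := key (n + 1) a
    refine ⟨fun z hz => ?_, fun z hz => ?_⟩
    · rw [eval_mul, eval_C, map_mul, mul_left_comm, h1 z hz, one_mul]
    · rw [eval_mul, eval_C, ← mul_assoc, huu, h2 z hz]
  set P : ℂ[X] := C u * P₀
  have hPdeg : P.natDegree ≤ n + 1 := by
    refine (natDegree_C_mul_le _ _).trans ((natDegree_prod_le _ _).trans ?_)
    simp
  have hQdeg : Q.natDegree ≤ n + 1 := by
    refine (natDegree_prod_le _ _).trans ?_
    refine (Finset.sum_le_card_nsmul _ _ 1 fun j _ => ?_).trans (by simp)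
    exact (natDegree_sub_le _ _).trans (by simpa using natDegree_C_mul_le (conj (a j)) X)
  have hQ0 : ∀ z ∈ disk, Q.eval z ≠ 0 := by
    intro z hz
    rw [hQ, eval_prod]
    refine Finset.prod_ne_zero_iff.2 fun j _ => ?_
    simpa using one_sub_conj_mul_ne_zero (ha j) (mem_disk_iff.1 hz).le
  have hfPQ : ∀ z ∈ disk, f z * Q.eval z = P.eval z := by
    intro z hz
    have h1 : P.eval z = u * ∏ j, (z - a j) := by simp [P, hP₀, eval_prod]
    have h2 : Q.eval z = ∏ j, (1 - conj (a j) * z) := by simp [hQ, eval_prod]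
    have h3 := hQ0 z hz
    rw [h2] at h3
    rw [h1, h2, hfa z hz, Finset.prod_div_distrib, mul_assoc, div_mul_cancel₀ _ h3]
  clear_value P
  -- `A / B` is `mobius z₀ ∘ f`. Its zero at `z₀` is divided out of `A` below, which lowers the
  -- degree to `n`.
  set A : ℂ[X] := P + C (-z₀) * Q with hA
  set B : ℂ[X] := Q + C (conj (-z₀)) * P with hBdef
  have hAB : IsReflection (n + 1) (conj u) A B := hPQ.1.add_C_mul hPQ.2
  have hAeval : ∀ z ∈ disk, A.eval z = (f z - z₀) * Q.eval z := by
    intro z hz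
    rw [hA, eval_add, eval_mul, eval_C, ← hfPQ z hz]
    ring
  have hBeval : ∀ z ∈ disk, B.eval z = (1 - conj z₀ * f z) * Q.eval z := by
    intro z hz
    rw [hBdef, eval_add, eval_mul, eval_C, ← hfPQ z hz, map_neg]
    ring
  have hAdeg : A.natDegree ≤ n + 1 :=
    natDegree_add_le_of_degree_le hPdeg ((natDegree_C_mul_le _ _).trans hQdeg)
  have hroot : A.IsRoot z₀ := by
    rw [IsRoot.def, hAeval z₀ hz₀, hfix, sub_self, zero_mul]
  set p := A /ₘ (X - C z₀)
  have hAp : (X - C z₀) * p = A := mul_divByMonic_eq_iff_isRoot.2 hroot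
  have hpdeg : p.natDegree ≤ n := by
    rw [natDegree_divByMonic _ (monic_X_sub_C z₀), natDegree_X_sub_C]
    omega
  -- Taking `b` as the reflection of `p` makes `B = (1 - conj z₀ X) b` follow by reflecting `A = (X
  -- - z₀) p`.
  obtain ⟨b, hbdeg, hpb⟩ := exists_isReflection hcu0 hpdeg
  have hBb : (1 - C (conj z₀) * X) * b = B := by
    refine eq_of_eval_eq_of_ne_zero fun z hz => mul_left_cancel₀ hcu0 ?_
    have h1 := hpb.X_sub_C_mul (a := z₀) z hz
    rw [hAp] at h1
    rw [← h1, hAB z hz]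
  have hb0 : ∀ z ∈ disk, b.eval z ≠ 0 := by
    intro z hz h0
    have h1 := hBeval z hz
    rw [← hBb, eval_mul, h0, mul_zero] at h1
    exact mul_ne_zero (one_sub_conj_mul_ne_zero hz₀ (mem_disk_iff.1 (hf.2 hz)).le) (hQ0 z hz)
      h1.symm
  have hoff : ∀ z ∈ disk, z ≠ z₀ → schwarzQuotient f z₀ z * b.eval z = p.eval z := by
    intro z hz hne
    have h1 := mobius_mul_schwarzQuotient hz₀ hfix hz
    have h2 := one_sub_conj_mul_ne_zero hz₀ (mem_disk_iff.1 (hf.2 hz)).le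
    have h3 := one_sub_conj_mul_ne_zero hz₀ (mem_disk_iff.1 hz).le
    have h4 := hAeval z hz
    have h5 := hBeval z hz
    rw [← hAp] at h4
    rw [← hBb] at h5
    simp only [eval_mul, eval_sub, eval_X, eval_C, eval_one] at h4 h5
    rw [mobius, mobius, div_mul_eq_mul_div, div_eq_div_iff h3 h2] at h1
    refine mul_left_cancel₀ (mul_ne_zero (sub_ne_zero.2 hne) (mul_ne_zero h2 h3)) ?_
    linear_combination b.eval z * (1 - conj z₀ * z) * h1 +
      (f z - z₀) * (1 - conj z₀ * z) * h5 - (1 - conj z₀ * f z) * (1 - conj z₀ * z) * h4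
  refine ⟨p, b, hpdeg, hbdeg, fun z hz => hpb.norm_eq hcu hz, fun z hz => ⟨hb0 z hz, ?_⟩⟩
  rcases ne_or_eq z z₀ with hne | rfl
  · exact hoff z hz hne
  · have hc := ((differentiableOn_schwarzQuotient hf hz).continuousOn.continuousAt
      (isOpen_disk.mem_nhds hz)).mul b.continuous.continuousAt
    refine tendsto_nhds_unique_of_eventuallyEq (l := 𝓝[≠] z)
      (hc.tendsto.mono_left nhdsWithin_le_nhds)
      (p.continuous.continuousAt.tendsto.mono_left nhdsWithin_le_nhds) ?_
    filter_upwards [self_mem_nhdsWithin, nhdsWithin_le_nhds (isOpen_disk.mem_nhds hz)] with x h1 h2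
    exact hoff x h2 h1

/-- For a Blaschke product of degree `n + 1` with `n` boundary fixed points, the real part of the
Herglotz function is the sum of its maximal Poisson kernel atoms at these points. -/
theorem IsBlaschkeProduct.re_herglotzFun_eq {f : ℂ → ℂ} {n : ℕ} (hB : IsBlaschkeProduct (n + 1) f)
    (hf : IsHolSelfMap f) (haut : ¬ IsDiskAut f) {z₀ : ℂ} (hz₀ : z₀ ∈ disk) (hfix : f z₀ = z₀)
    {σ : Fin n → ℂ} (hσ : ∀ j, ‖σ j‖ = 1) (hinj : Function.Injective σ)
    (hlim : ∀ j, Tendsto (fun r : ℝ => f (r * σ j)) (𝓝[<] 1) (𝓝 (σ j))) {c : Fin n → ℝ}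
    (hc0 : ∀ j, 0 < c j)
    (hc : ∀ j, ∀ z ∈ disk, c j * poisson (σ j) z ≤ (herglotzFun f z₀ z).re)
    (hmax : ∀ j, ∀ x : ℝ, (∀ z ∈ disk, x * poisson (σ j) z ≤ (herglotzFun f z₀ z).re) → x ≤ c j) :
    ∀ z ∈ disk, (herglotzFun f z₀ z).re = ∑ j, c j * poisson (σ j) z := by
  obtain ⟨p, b, hpdeg, hbdeg, hnorm, hpb⟩ := hB.exists_schwarzQuotient hf hz₀ hfix
  have hFd := differentiableOn_herglotzFun hf haut hz₀ hfix
  have hFpos := re_herglotzFun_nonneg hf hz₀ hfix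
  -- The radial limit of `q = p / b` at `σ j` is `1`.
  have hbσ : ∀ j, (b - p).eval (σ j) = 0 := by
    intro j
    rw [eval_sub, sub_eq_zero]
    have h1 := (tendsto_schwarzQuotient hz₀ hfix (hσ j) (hlim j)).mul
      ((b.continuous.tendsto _).comp (tendsto_ofReal_mul (σ j)))
    have h2 := (p.continuous.tendsto _).comp (tendsto_ofReal_mul (σ j))
    rw [one_mul] at h1
    refine tendsto_nhds_unique_of_eventuallyEq h1 h2 ?_
    filter_upwards [eventually_mem_Ioo_zero_one] with r hr
    exact (hpb _ (ofReal_mul_mem_disk (hσ j) hr)).2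
  obtain ⟨κ, hκ⟩ := exists_eq_C_mul_prod_of_forall_eval_eq_zero hinj
    ((natDegree_sub_le _ _).trans (max_le hbdeg hpdeg)) hbσ
  have hD0 : ∀ z ∈ disk, (b - p).eval z ≠ 0 := by
    intro z hz
    rw [eval_sub, ← (hpb z hz).2, ← one_sub_mul]
    exact mul_ne_zero (one_sub_schwarzQuotient_ne_zero hf haut hz₀ hfix hz) (hpb z hz).1
  have hF : ∀ z ∈ disk, herglotzFun f z₀ z * (b - p).eval z = (b + p).eval z := by
    intro z hz
    rw [eval_sub, eval_add, ← (hpb z hz).2, herglotzFun]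
    have := one_sub_schwarzQuotient_ne_zero hf haut hz₀ hfix hz
    field_simp
  have hκ0 : κ ≠ 0 := by
    rintro rfl
    refine hD0 z₀ hz₀ ?_
    rw [hκ, map_zero, zero_mul, eval_zero]
  set D := poleDenominator σ with hDdef
  obtain ⟨μ, hμ0, hμ⟩ : ∃ μ : ℂ, μ ≠ 0 ∧ b - p = C μ * D := by
    refine ⟨κ * (-1) ^ n, mul_ne_zero hκ0 (pow_ne_zero _ (by norm_num)), ?_⟩
    have : D = (-1) ^ n * ∏ j, (X - C (σ j)) := by
      rw [hDdef, poleDenominator]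
      have h : ((-1) ^ n : ℂ[X]) = ∏ _j : Fin n, (-1) := by simp
      rw [h, ← Finset.prod_mul_distrib]
      exact Finset.prod_congr rfl fun j _ => by ring
    have h2 : ((-1) ^ n * (-1) ^ n : ℂ[X]) = 1 := by
      rw [← mul_pow]; simp
    rw [hκ, this, C_mul, map_pow, map_neg, C_1]
    linear_combination (-(C κ * ∏ j, (X - C (σ j)))) * h2
  set G : ℂ → ℂ := fun z => herglotzFun f z₀ z - ∑ j, c j * herglotzKernel (σ j) z with hG
  have hGd : DifferentiableOn ℂ G disk := differentiableOn_sub_sum_herglotzKernel hσ hFd _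
  have hGre : ∀ z, (G z).re = (herglotzFun f z₀ z).re - ∑ j, c j * poisson (σ j) z :=
    fun z => re_sub_sum_herglotzKernel hσ _ _ z
  have hGpos : ∀ z ∈ disk, 0 ≤ (G z).re := by
    intro z hz
    rw [hGre]
    exact sub_nonneg.2 (sum_mul_poisson_le_re hσ hinj hFd hFpos hc Finset.univ z hz)
  -- `R` is the numerator of `G` over the denominator `D`.
  set R : ℂ[X] := C μ⁻¹ * (b + p) - kernelNumerator σ c 0 with hR
  have hRdeg : R.natDegree ≤ n := by
    refine (natDegree_sub_le _ _).trans (max_le ?_ natDegree_kernelNumerator_le)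
    exact (natDegree_C_mul_le _ _).trans (natDegree_add_le_of_degree_le hbdeg hpdeg)
  have hGD : ∀ z ∈ disk, G z * D.eval z = R.eval z := by
    intro z hz
    have hne : ∀ j, σ j ≠ z := fun j => sub_ne_zero.1 (sub_ne_zero_of_mem_disk (hσ j) hz)
    rw [hR, eval_sub, eval_mul, eval_C, ← hF z hz, hμ, eval_mul, eval_C,
      eval_kernelNumerator_of_ne hne, zero_add, hG, ← hDdef, sub_mul]
    field_simp
  -- If `R` did not vanish at `σ j`, then `G` would have a pole there whose normalized residue is
  -- real and positive; half of it could be added to `c j`, contradicting maximality.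
  have hRσ : ∀ j, R.eval (σ j) = 0 := by
    intro j
    set S : ℂ → ℂ := fun z => R.eval z / ∏ i ∈ Finset.univ.erase j, (σ i - z) with hS
    have hS0 : ∀ i ∈ Finset.univ.erase j, σ i - σ j ≠ 0 := fun i hi =>
      sub_ne_zero.2 fun h => (Finset.mem_erase.1 hi).1 (hinj h)
    have hScont : ContinuousAt S (σ j) := by
      refine ContinuousAt.div R.continuous.continuousAt (by fun_prop) ?_
      exact Finset.prod_ne_zero_iff.2 hS0
    have hL : Tendsto (fun z => G z * (σ j - z)) (𝓝[disk] (σ j)) (𝓝 (S (σ j))) := by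
      refine (hScont.tendsto.mono_left nhdsWithin_le_nhds).congr' ?_
      filter_upwards [self_mem_nhdsWithin] with z hz
      have hne : ∏ i ∈ Finset.univ.erase j, (σ i - z) ≠ 0 :=
        Finset.prod_ne_zero_iff.2 fun i _ => sub_ne_zero_of_mem_disk (hσ i) hz
      rw [hS]
      simp only
      rw [div_eq_iff hne, ← hGD z hz, hDdef, eval_poleDenominator,
        ← Finset.mul_prod_erase _ _ (Finset.mem_univ j)]
      ring
    obtain ⟨him, hge⟩ := im_eq_zero_and_re_nonneg_of_tendsto hGpos (hσ j) hL
    have hres := fun z (hz : z ∈ disk) => residue_mul_poisson_le_re hGd hGpos (hσ j) hL hz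
    have hle : (S (σ j) / σ j).re ≤ 0 := by
      have := hmax j (c j + (S (σ j) / σ j).re / 2) fun z hz => by
        have h1 := hres z hz
        rw [hGre] at h1
        have h2 : c j * poisson (σ j) z ≤ ∑ i, c i * poisson (σ i) z :=
          Finset.single_le_sum (f := fun i => c i * poisson (σ i) z)
            (fun i _ => mul_nonneg (hc0 i).le (poisson_pos (hσ i) hz).le) (Finset.mem_univ j)
        rw [add_mul]
        linarith
      linarith
    have hz : S (σ j) / σ j = 0 := Complex.ext (le_antisymm hle hge) him
    have hσ0 : σ j ≠ 0 := norm_ne_zero_iff.1 (by rw [hσ j]; exact one_ne_zero)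
    have hSz : S (σ j) = 0 := (div_eq_zero_iff.1 hz).resolve_right hσ0
    exact (div_eq_zero_iff.1 hSz).resolve_right (Finset.prod_ne_zero_iff.2 hS0)
  obtain ⟨ν, hν⟩ := exists_eq_C_mul_prod_of_forall_eval_eq_zero hinj hRdeg hRσ
  have hRD : C κ * R = C (ν * μ) * D := by
    rw [C_mul, mul_assoc, ← hμ, hκ, hν]
    ring
  have hRD' : ∀ z, R.eval z = ν * μ / κ * D.eval z := by
    intro z
    have := congrArg (eval z) hRD
    rw [eval_mul, eval_mul, eval_C, eval_C] at this
    field_simp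
    linear_combination this
  -- The polynomial identities also hold at a point `ζ` of the circle that is not a pole, where `|b|
  -- = |p|` and all the Poisson kernels vanish.
  have hs0 : (ν * μ / κ).re = 0 := by
    obtain ⟨ζ, hζ, hζσ⟩ := exists_mem_sphere_forall_ne σ
    have hDζ : D.eval ζ ≠ 0 := by
      rw [hDdef, eval_poleDenominator]
      exact Finset.prod_ne_zero_iff.2 fun j _ => sub_ne_zero.2 (hζσ j)
    have h1 := hRD' ζ
    have h2 : (b - p).eval ζ = μ * D.eval ζ := by rw [hμ, eval_mul, eval_C]
    rw [hR, eval_sub, eval_kernelNumerator_of_ne hζσ, eval_mul, eval_C, zero_add, ← hDdef] at h1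
    have h3 : ν * μ / κ = (b.eval ζ + p.eval ζ) / (b.eval ζ - p.eval ζ) -
        ∑ j, c j * herglotzKernel (σ j) ζ := by
      rw [← eval_sub, h2, ← eval_add]
      refine mul_right_cancel₀ hDζ ?_
      rw [← h1, sub_mul]
      field_simp
    rw [h3, Complex.sub_re, re_add_div_sub, hnorm ζ hζ, sub_self, zero_div, Complex.re_sum, zero_sub,
      neg_eq_zero]
    refine Finset.sum_eq_zero fun j _ => ?_
    rw [Complex.re_ofReal_mul, re_herglotzKernel (hσ j), poisson, hζ]
    simp
  intro z hz
  have h1 : G z = ν * μ / κ := by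
    have hDz : D.eval z ≠ 0 := by
      have := hD0 z hz
      rw [hμ, eval_mul] at this
      exact right_ne_zero_of_mul this
    refine mul_right_cancel₀ hDz ?_
    rw [hGD z hz, hRD' z]
  have h2 := hGre z
  rw [h1, hs0] at h2
  linarith

/-! ### The proposition -/

theorem proposition2p9 (f : ℂ → ℂ) (hf : IsHolSelfMap f) (haut : ¬ IsDiskAut f)
    (z₀ : ℂ) (hz₀ : z₀ ∈ disk) (hfix : f z₀ = z₀)
    (n : ℕ) (σ : Fin n → ℂ) (hσ : ∀ j, σ j ∈ Metric.sphere (0 : ℂ) 1)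
    (hinj : Function.Injective σ)
    (hβ : ∀ j, boundaryDilation f (σ j) < ⊤)
    (hσfix : ∀ j, HasNontangentialLimit f (σ j) (σ j)) :
    deriv f z₀ ≠ 1 ∧ (∀ j, 1 < boundaryDilation f (σ j)) ∧
    (∑ j, 1 / ((boundaryDilation f (σ j)).toReal - 1) ≤
      (1 - ‖deriv f z₀‖ ^ 2) / ‖1 - deriv f z₀‖ ^ 2) ∧
    (∑ j, 1 / ((boundaryDilation f (σ j)).toReal - 1) =
      (1 - ‖deriv f z₀‖ ^ 2) / ‖1 - deriv f z₀‖ ^ 2 ↔ IsBlaschkeProduct (n + 1) f) := by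
  have hσ' : ∀ j, ‖σ j‖ = 1 := fun j => by simpa using hσ j
  have hlim := fun j => (hσfix j).tendsto_radial (hσ' j)
  have hspec := fun j => boundaryDilation_spec hf haut hz₀ hfix (hσ' j) (hβ j) (hlim j)
  -- The maximal atoms of `Re F`, normalized so that `c j * poisson (σ j) z₀ = 1 / (β_j - 1)`.
  set c : Fin n → ℝ :=
    fun j => 1 / (((boundaryDilation f (σ j)).toReal - 1) * poisson (σ j) z₀) with hc_def
  have hFd := differentiableOn_herglotzFun hf haut hz₀ hfix
  have hFpos := re_herglotzFun_nonneg hf hz₀ hfix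
  have hc0 : ∀ j, 0 < c j := fun j =>
    one_div_pos.2 (mul_pos (sub_pos.2 (hspec j).1) (poisson_pos (hσ' j) hz₀))
  have hsum : ∀ z ∈ disk, ∑ j, c j * poisson (σ j) z ≤ (herglotzFun f z₀ z).re :=
    sum_mul_poisson_le_re hσ' hinj hFd hFpos (fun j => (hspec j).2.1) Finset.univ
  have hval : (herglotzFun f z₀ z₀).re = (1 - ‖deriv f z₀‖ ^ 2) / ‖1 - deriv f z₀‖ ^ 2 := by
    rw [re_herglotzFun, schwarzQuotient_self hz₀ hfix]
  have hterm : ∑ j, 1 / ((boundaryDilation f (σ j)).toReal - 1) =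
      ∑ j, c j * poisson (σ j) z₀ := by
    refine Finset.sum_congr rfl fun j _ => ?_
    have := (poisson_pos (hσ' j) hz₀).ne'
    simp only [hc_def]
    rw [← div_div, div_mul_cancel₀ _ this]
  rw [← hval, hterm]
  refine ⟨?_, fun j => ?_, hsum z₀ hz₀, fun heq => ?_, fun hB => ?_⟩
  · have := one_sub_schwarzQuotient_ne_zero hf haut hz₀ hfix hz₀
    rw [schwarzQuotient_self hz₀ hfix] at this
    exact (sub_ne_zero.1 this).symm
  · rw [← ENNReal.toReal_lt_toReal ENNReal.one_ne_top (hβ j).ne, ENNReal.toReal_one]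
    exact (hspec j).1
  -- Equality says that the real part left after removing all the atoms vanishes at the interior
  -- point `z₀`.
  · obtain ⟨w, hw, hconst⟩ := exists_eq_const_of_re_nonneg
      (differentiableOn_sub_sum_herglotzKernel (c := c) hσ' hFd Finset.univ)
      (fun z hz => by
        rw [re_sub_sum_herglotzKernel hσ']
        exact sub_nonneg.2 (hsum z hz)) hz₀
      (by rw [re_sub_sum_herglotzKernel hσ', heq, sub_self])
    exact isBlaschkeProduct_of_herglotzFun_eq hf haut hz₀ hfix hσ' hinj hc0 hw
      fun z hz => sub_eq_iff_eq_add.1 (hconst z hz)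
  · exact (hB.re_herglotzFun_eq hf haut hz₀ hfix hσ' hinj hlim hc0 (fun j => (hspec j).2.1)
      (fun j => (hspec j).2.2) z₀ hz₀).symm
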